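/- Use coordinates $(x,y,z)$ on $\mathbb{R}^3\subset S^3$, with diagrams drawn in the $xy$-plane, $y$ vertical and $z$ pointing towards the viewer. An oriented knot is a smooth embedding of the oriented circle; its mirror image $\overline{K}$ is its image under $(x,y,z)\mapsto(x,y,-z)$, its reverse $r(K)$ is the same circle with the opposite orientation, and two oriented knots are isotopic if they are joined by a smooth one-parameter family of smooth embeddings of the oriented circle. A pure two-component string link $J$ is a smooth proper embedding of two disjoint intervals in $D^2\times[0,1]$ ($D^2$ the unit disk of the $xz$-plane, $[0,1]$ in the $y$-direction), vertical at its ends to infinite order, in which the $i$-th strand runs from the $i$-th base point at the bottom to the $i$-th base point at the top, the two base points being $(x,z)=(\mp\frac12,0)$. Write $\overline{J}$ for its image under $(x,y,z)\mapsto(x,y,-z)$ and $f(x,y,z)=(-x,y,-z)$ for the rotation by $180^\circ$ about the $y$-axis. Let $K=K(J)$ be the knot obtained as follows. Start with a flat disk at the bottom of the diagram and attach two unknotted, untwisted bands (arches, flat in the diagram) to its upper side, with interlaced feet (from left to right: left-hand band, right-hand band, left-hand band, right-hand band), so that the left-hand band passes over the right-hand band at their single crossing. The boundary of this surface is a closed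 curve; replace the two parallel vertical strands at the outer leg of the left-hand band by $J$, and the two parallel vertical strands at the outer leg of the right-hand band by $f(\overline{J})$. Give $K$ an orientation. Then, for every pure two-component string link $J$, the closed curve $K$ is a knot and is negative amphichiral: $K$ is isotopic to $r(\overline{K})$. -/

import Mathlib

open scoped ContDiff

noncomputable section

/-- Euclidean 3-space with coordinates `(x, y, z)`; diagrams are drawn in the `xy`-plane, `y` is
vertical, and `z` points towards the viewer. -/
abbrev R3 : Type := EuclideanSpace ℝ (Fin 3)

/-- An oriented knot: a smooth embedding of the oriented circle `ℝ / ℤ`, written as a smooth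
`1`-periodic immersion `ℝ → ℝ³` that is injective modulo `ℤ`. -/
structure IsKnot (γ : ℝ → R3) : Prop where
  smooth : ContDiff ℝ ∞ γ
  periodic : ∀ s, γ (s + 1) = γ s
  immersion : ∀ s, deriv γ s ≠ 0
  injective : ∀ s t, γ s = γ t → ∃ n : ℤ, s = t + n

/-- Smooth isotopy of oriented knots: a smooth one-parameter family of smooth embeddings of the
oriented circle, from `γ₀` to `γ₁`. -/
def Isotopic (γ₀ γ₁ : ℝ → R3) : Prop :=
  ∃ F : ℝ → ℝ → R3,
    ContDiffOn ℝ ∞ (fun p : ℝ × ℝ => F p.1 p.2) (Set.Icc 0 1 ×ˢ Set.univ) ∧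
    (∀ t ∈ Set.Icc (0 : ℝ) 1, IsKnot (F t)) ∧ F 0 = γ₀ ∧ F 1 = γ₁

/-- The reflection `(x, y, z) ↦ (x, y, -z)` in the plane of the diagram. -/
def mirrorMap (p : R3) : R3 := !₂[p 0, p 1, -p 2]

/-- The flip `f (x, y, z) = (-x, y, -z)`, the rotation by 180 degrees about the `y`-axis. -/
def flipMap (p : R3) : R3 := !₂[-p 0, p 1, -p 2]

/-- The mirror image of a knot. -/
def mirrorImage (γ : ℝ → R3) : ℝ → R3 := fun s => mirrorMap (γ s)

/-- The reverse of a knot: the same circle with the opposite orientation. -/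
def reverseKnot (γ : ℝ → R3) : ℝ → R3 := fun s => γ (-s)

/-- `K` is negative amphichiral: a knot that is isotopic to the reverse of its mirror image. -/
def NegativeAmphichiral (γ : ℝ → R3) : Prop :=
  IsKnot γ ∧ Isotopic γ (reverseKnot (mirrorImage γ))

/-- The `x`-coordinates of the two base points of a string link: `-1/2` and `1/2`. -/
def basePoint : Fin 2 → ℝ := ![-(1 / 2), 1 / 2]

/-- A pure two-component string link: a smooth proper embedding of two disjoint intervals in
`D² × [0, 1]`, where `D²` is the unit disk of the `xz`-plane and the factor `[0, 1]` is the
`y`-direction, such that each strand runs from its base point at the bottom to the same base point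
at the top. The strands meet the ends of the cylinder in the product way, so that they extend
smoothly by vertical rays; `strand i` is the extended strand, and the string link itself is its
restriction to `[0, 1]`. -/
structure StringLink where
  strand : Fin 2 → ℝ → R3
  smooth : ∀ i, ContDiff ℝ ∞ (strand i)
  immersion : ∀ i t, deriv (strand i) t ≠ 0
  injective : ∀ i j s t, strand i s = strand j t → i = j ∧ s = t
  vertical : ∀ i t, t ≤ 0 ∨ 1 ≤ t → strand i t = !₂[basePoint i, t, 0]
  inside : ∀ i, ∀ t ∈ Set.Ioo (0 : ℝ) 1,
    (strand i t 0) ^ 2 + (strand i t 2) ^ 2 < 1 ∧ strand i t 1 ∈ Set.Ioo (0 : ℝ) 1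

/-- A smooth convex function that is `0` for `s ≤ -1/4` and `s` for `1/4 ≤ s`. -/
def ramp (s : ℝ) : ℝ := ∫ u in (-(1 / 4) : ℝ)..s, Real.smoothTransition (2 * u + 1 / 2)

/-- The polygonal path through the points `v 0, …, v 5` with rounded corners. The edge from `v k`
to `v (k + 1)` is run through linearly in the time interval `[k, k + 1]`, except that the velocity
changes smoothly, within time `1/4` of the corner, from one edge vector to the next. -/
def roundedPath (v : Fin 6 → R3) (s : ℝ) : R3 :=
  v 0 + s • (v 1 - v 0)
    + ramp (s - 1) • ((v 2 - v 1) - (v 1 - v 0))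
    + ramp (s - 2) • ((v 3 - v 2) - (v 2 - v 1))
    + ramp (s - 3) • ((v 4 - v 3) - (v 3 - v 2))
    + ramp (s - 4) • ((v 5 - v 4) - (v 4 - v 3))

/-- The strands of `J` in the left-hand cylinder, which is centred over `(-4, 0, 1)`. -/
def leftStrand (J : StringLink) (i : Fin 2) (t : ℝ) : R3 := !₂[-4, 0, 1] + J.strand i t

/-- The strands of `f(J̄)` in the right-hand cylinder, which is centred over `(4, 0, -1)`. As `f`
exchanges the two base points, the strand on the left here is the image of `J.strand 1`, and
the strand on the right is the image of `J.strand 0`. -/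
def rightStrand (J : StringLink) (i : Fin 2) (t : ℝ) : R3 :=
  !₂[4, 0, -1] + flipMap (mirrorMap (J.strand i t))

/-- From the top of the outer strand on the left, along the outer edge of the left-hand band, which
lies in front of the right-hand band, down to the disk and on to the bottom of the inner strand on
the right. -/
def arcA : Fin 6 → R3 :=
  ![!₂[-9 / 2, 1, 1], !₂[-9 / 2, 2, 1], !₂[-3, 4, 1], !₂[2, -1, 1],
    !₂[7 / 2, -1, -1], !₂[7 / 2, 0, -1]]

/-- From the top of the inner strand on the right, along the inner edge of the right-hand band down
to the disk, and up along the inner edge of the left-hand band to the top of the inner strand on the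
left. -/
def arcB : Fin 6 → R3 :=
  ![!₂[7 / 2, 1, -1], !₂[7 / 2, 2, -1], !₂[-1, -1, -1], !₂[1, -1, 1],
    !₂[-7 / 2, 2, 1], !₂[-7 / 2, 1, 1]]

/-- From the bottom of the inner strand on the left to the other foot of the right-hand band, and
along the outer edge of that band, behind the left-hand band, to the top of the outer strand on
the right. -/
def arcC : Fin 6 → R3 :=
  ![!₂[-7 / 2, 0, 1], !₂[-7 / 2, -1, 1], !₂[-2, -1, -1], !₂[3, 4, -1],
    !₂[9 / 2, 2, -1], !₂[9 / 2, 1, -1]]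

/-- From the bottom of the outer strand on the right, along the lower boundary of the disk, to the
bottom of the outer strand on the left. -/
def arcD : Fin 6 → R3 :=
  ![!₂[9 / 2, 0, -1], !₂[9 / 2, -1, -1], !₂[7 / 2, -2, -1], !₂[-7 / 2, -2, 1],
    !₂[-9 / 2, -1, 1], !₂[-9 / 2, 0, 1]]

/-- One turn around the knot `K`, for `u` from `0` to `24`. The knot is the boundary of a disk
(at the bottom of the diagram) with two untwisted, unknotted bands attached to its upper side, with
interlaced feet, the left-hand band passing over the right-hand band, after the two parallel
vertical strands of the left-hand band are replaced by `J` and those of the right-hand band by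
`f(J̄)`. -/
def figureLoop (J : StringLink) (u : ℝ) : R3 :=
  if u < 1 then leftStrand J 0 u
  else if u < 6 then roundedPath arcA (u - 1)
  else if u < 7 then rightStrand J 1 (u - 6)
  else if u < 12 then roundedPath arcB (u - 7)
  else if u < 13 then leftStrand J 1 (13 - u)
  else if u < 18 then roundedPath arcC (u - 13)
  else if u < 19 then rightStrand J 0 (19 - u)
  else roundedPath arcD (u - 19)

/-- The knot `K` built from the string link `J`, as a `1`-periodic map. -/
def figureKnot (J : StringLink) (s : ℝ) : R3 := figureLoop J (24 * Int.fract s)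

end

/-!
A straight-line homotopy moves the figure to a standard position, in which both cylinders are
centred on the line `y = 1/2`, `z = 0`. The curve stays embedded on the way, because for any two of
finitely many short pieces some integer linear functional separates them at both ends of the
homotopy, and therefore throughout.

In the standard position the middle and the lower arc lie in the plane `z = 0`, and each of the two
outer arcs makes half a turn about the line. A full untwist about the line, cut off so that it fixes
the cylinders and the middle and lower arcs, turns both half turns into the opposite half turns,
hence the outer arcs into their mirror images. The two cylinders contain `J` and `f(J̄)`, so the
flip `f` carries the mirror image of each of them to the other, and it preserves the standard
position of the arcs with the direction reversed. Thus the result of the untwist is `f` of the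
reversed mirror image, and a rotation about the `y`-axis removes `f`.
-/

noncomputable section

/-! ### Knots and isotopies -/

theorem deriv_comp_ne_zero_of_leftInverse {E F : Type*} [NormedAddCommGroup E] [NormedSpace ℝ E]
    [NormedAddCommGroup F] [NormedSpace ℝ F] {Φ : E → F} {Ψ : F → E} (hΦ : Differentiable ℝ Φ)
    (hΨ : Differentiable ℝ Ψ) (inv : Function.LeftInverse Ψ Φ) {γ : ℝ → E} {s : ℝ}
    (hγ : deriv γ s ≠ 0) : deriv (fun s => Φ (γ s)) s ≠ 0 := by
  intro h0
  have hΦγ : HasDerivAt (fun s => Φ (γ s)) 0 s :=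
    h0 ▸ ((hΦ _).comp s (differentiableAt_of_deriv_ne_zero hγ)).hasDerivAt
  have hΨΦγ := (hΨ (Φ (γ s))).hasFDerivAt.comp_hasDerivAt s hΦγ
  rw [show Ψ ∘ (fun s => Φ (γ s)) = γ from funext fun s => inv (γ s), map_zero] at hΨΦγ
  exact hγ hΨΦγ.deriv

theorem IsKnot.comp_left {γ : ℝ → R3} (h : IsKnot γ) {Φ Ψ : R3 → R3} (hΦ : ContDiff ℝ ∞ Φ)
    (hΨ : Differentiable ℝ Ψ) (inv : Function.LeftInverse Ψ Φ) :
    IsKnot (fun s => Φ (γ s)) where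
  smooth := hΦ.comp h.smooth
  periodic s := by simp only [h.periodic]
  immersion s :=
    deriv_comp_ne_zero_of_leftInverse (hΦ.differentiable (by simp)) hΨ inv (h.immersion s)
  injective s t hst := h.injective s t (inv.injective hst)

theorem IsKnot.shift {γ : ℝ → R3} (h : IsKnot γ) (c : ℝ) : IsKnot (fun s => γ (s + c)) where
  smooth := h.smooth.comp (by fun_prop)
  periodic s := by rw [add_right_comm, h.periodic]
  immersion s := by rw [deriv_comp_add_const]; exact h.immersion _
  injective s t hst := by
    obtain ⟨n, hn⟩ := h.injective _ _ hst
    exact ⟨n, by linarith⟩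

theorem IsKnot.reverse {γ : ℝ → R3} (h : IsKnot γ) : IsKnot (reverseKnot γ) where
  smooth := h.smooth.comp (by fun_prop)
  periodic s := by
    rw [reverseKnot, reverseKnot, ← h.periodic (-(s + 1)), neg_add, neg_add_cancel_right]
  immersion s := by
    unfold reverseKnot
    rw [deriv_comp_neg]
    exact neg_ne_zero.2 (h.immersion _)
  injective s t hst := by
    obtain ⟨n, hn⟩ := h.injective _ _ hst
    exact ⟨-n, by push_cast; linarith⟩

theorem contDiff_vec3 {E : Type*} [NormedAddCommGroup E] [NormedSpace ℝ E] {a b c : E → ℝ}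
    {n : WithTop ℕ∞} (ha : ContDiff ℝ n a) (hb : ContDiff ℝ n b) (hc : ContDiff ℝ n c) :
    ContDiff ℝ n (fun e => (!₂[a e, b e, c e] : R3)) := by
  rw [contDiff_euclidean]
  intro i
  fin_cases i
  · exact ha
  · exact hb
  · exact hc

theorem contDiff_coord {n : WithTop ℕ∞} (i : Fin 3) : ContDiff ℝ n (fun p : R3 => p i) :=
  (EuclideanSpace.proj (𝕜 := ℝ) i : R3 →L[ℝ] ℝ).contDiff

theorem contDiff_mirrorMap : ContDiff ℝ ∞ mirrorMap :=
  contDiff_vec3 (contDiff_coord 0) (contDiff_coord 1) (contDiff_coord 2).neg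

theorem contDiff_flipMap : ContDiff ℝ ∞ flipMap :=
  contDiff_vec3 (contDiff_coord 0).neg (contDiff_coord 1) (contDiff_coord 2).neg

theorem mirrorMap_mirrorMap (p : R3) : mirrorMap (mirrorMap p) = p := by
  ext i; fin_cases i <;> simp [mirrorMap]

theorem flipMap_flipMap (p : R3) : flipMap (flipMap p) = p := by
  ext i; fin_cases i <;> simp [flipMap]

theorem IsKnot.mirror {γ : ℝ → R3} (h : IsKnot γ) : IsKnot (mirrorImage γ) :=
  h.comp_left contDiff_mirrorMap (contDiff_mirrorMap.differentiable (by simp)) mirrorMap_mirrorMap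

theorem Isotopic.symm {γ₀ γ₁ : ℝ → R3} (h : Isotopic γ₀ γ₁) : Isotopic γ₁ γ₀ := by
  obtain ⟨F, hF, hk, h0, h1⟩ := h
  refine ⟨fun t => F (1 - t), ?_, fun t ht => hk _ ⟨by linarith [ht.2], by linarith [ht.1]⟩,
    by simpa using h1, by simpa using h0⟩
  refine hF.comp (f := fun p : ℝ × ℝ => (1 - p.1, p.2)) (by fun_prop) ?_
  rintro ⟨t, s⟩ ⟨ht, -⟩
  exact ⟨⟨by linarith [ht.2], by linarith [ht.1]⟩, trivial⟩

theorem Isotopic.exists_stationary {γ₀ γ₁ : ℝ → R3} (h : Isotopic γ₀ γ₁) :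
    ∃ F : ℝ → ℝ → R3, ContDiff ℝ ∞ (fun p : ℝ × ℝ => F p.1 p.2) ∧ (∀ t, IsKnot (F t)) ∧
      (∀ t ≤ 1 / 4, F t = γ₀) ∧ ∀ t ≥ 3 / 4, F t = γ₁ := by
  obtain ⟨F, hF, hk, h0, h1⟩ := h
  have mem : ∀ x, Real.smoothTransition x ∈ Set.Icc (0 : ℝ) 1 := fun x =>
    ⟨Real.smoothTransition.nonneg x, Real.smoothTransition.le_one x⟩
  refine ⟨fun t => F (Real.smoothTransition (2 * t - 1 / 2)), ?_, fun t => hk _ (mem _),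
    fun t ht => (congrArg F (Real.smoothTransition.zero_of_nonpos (by linarith))).trans h0,
    fun t ht => (congrArg F (Real.smoothTransition.one_of_one_le (by linarith))).trans h1⟩
  rw [← contDiffOn_univ]
  refine hF.comp (f := fun p : ℝ × ℝ => (Real.smoothTransition (2 * p.1 - 1 / 2), p.2)) ?_
    fun p _ => ⟨mem _, trivial⟩
  exact ((Real.smoothTransition.contDiff.comp (by fun_prop)).prodMk contDiff_snd).contDiffOn

theorem Isotopic.trans {γ₀ γ₁ γ₂ : ℝ → R3} (h : Isotopic γ₀ γ₁) (h' : Isotopic γ₁ γ₂) :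
    Isotopic γ₀ γ₂ := by
  obtain ⟨F, hF, hFk, hF0, hF1⟩ := h.exists_stationary
  obtain ⟨G, hG, hGk, hG0, hG1⟩ := h'.exists_stationary
  let H : ℝ → ℝ → R3 := fun t => if t ≤ 1 / 2 then F (2 * t) else G (2 * t - 1)
  have H_left : ∀ t < 5 / 8, H t = F (2 * t) := fun t ht => by
    by_cases h : t ≤ 1 / 2
    · exact if_pos h
    · rw [show H t = G (2 * t - 1) from if_neg h, hG0 _ (by linarith), hF1 _ (by linarith)]
  have H_right : ∀ t > 3 / 8, H t = G (2 * t - 1) := fun t ht => by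
    by_cases h : t ≤ 1 / 2
    · rw [show H t = F (2 * t) from if_pos h, hG0 _ (by linarith), hF1 _ (by linarith)]
    · exact if_neg h
  refine ⟨H, (contDiff_iff_contDiffAt.2 fun p => ?_).contDiffOn, fun t _ => ?_, ?_, ?_⟩
  · rcases lt_or_ge p.1 (5 / 8) with hp | hp
    · have hF' : ContDiff ℝ ∞ fun q : ℝ × ℝ => F (2 * q.1) q.2 :=
        hF.comp (f := fun q : ℝ × ℝ => (2 * q.1, q.2)) (by fun_prop)
      refine hF'.contDiffAt.congr_of_eventuallyEq ?_
      filter_upwards [(isOpen_lt continuous_fst continuous_const).mem_nhds hp] with q hq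
      rw [H_left _ hq]
    · have hG' : ContDiff ℝ ∞ fun q : ℝ × ℝ => G (2 * q.1 - 1) q.2 :=
        hG.comp (f := fun q : ℝ × ℝ => (2 * q.1 - 1, q.2)) (by fun_prop)
      have hp : (3 / 8 : ℝ) < p.1 := by linarith
      refine hG'.contDiffAt.congr_of_eventuallyEq ?_
      filter_upwards [(isOpen_lt continuous_const continuous_fst).mem_nhds hp] with q hq
      rw [H_right _ hq]
  · rcases lt_or_ge t (5 / 8) with ht | ht
    · exact H_left t ht ▸ hFk _
    · exact H_right t (by linarith) ▸ hGk _
  · rw [H_left 0 (by norm_num), hF0 _ (by norm_num)]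
  · rw [H_right 1 (by norm_num), hG1 _ (by norm_num)]

theorem Isotopic.reverse_mirror {γ₀ γ₁ : ℝ → R3} (h : Isotopic γ₀ γ₁) :
    Isotopic (reverseKnot (mirrorImage γ₀)) (reverseKnot (mirrorImage γ₁)) := by
  obtain ⟨F, hF, hk, rfl, rfl⟩ := h
  refine ⟨fun t => reverseKnot (mirrorImage (F t)), ?_, fun t ht => (hk t ht).mirror.reverse,
    rfl, rfl⟩
  exact contDiff_mirrorMap.comp_contDiffOn
    (hF.comp (f := fun p : ℝ × ℝ => (p.1, -p.2)) (by fun_prop) fun p hp => ⟨hp.1, trivial⟩)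

theorem IsKnot.isotopic_ambient {γ : ℝ → R3} (h : IsKnot γ) {Φ : ℝ → R3 → R3}
    (hΦ : ContDiff ℝ ∞ fun q : ℝ × R3 => Φ q.1 q.2) (h0 : Φ 0 = id)
    (h_neg : ∀ t p, Φ (-t) (Φ t p) = p) : Isotopic γ fun s => Φ 1 (γ s) := by
  have h_stage (t : ℝ) : ContDiff ℝ ∞ (Φ t) := hΦ.comp (contDiff_const.prodMk contDiff_id)
  refine ⟨fun t s => Φ t (γ s), ?_, fun t _ => ?_, by simp [h0], rfl⟩
  · exact (hΦ.comp (contDiff_fst.prodMk (h.smooth.comp contDiff_snd))).contDiffOn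
  · exact h.comp_left (h_stage t) ((h_stage (-t)).differentiable (by simp)) (h_neg t)

theorem IsKnot.isotopic_shift {γ : ℝ → R3} (h : IsKnot γ) (c : ℝ) :
    Isotopic γ (fun s => γ (s + c)) := by
  refine ⟨fun t s => γ (s + t * c), ?_, fun t _ => h.shift _, by simp, by simp⟩
  exact (h.smooth.comp (by fun_prop)).contDiffOn

/-! ### The ramp function -/

theorem smoothTransition_add_one_sub (x : ℝ) :
    Real.smoothTransition x + Real.smoothTransition (1 - x) = 1 := by
  unfold Real.smoothTransition
  rw [sub_sub_cancel, add_comm (expNegInvGlue (1 - x)), ← add_div,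
    div_self (Real.smoothTransition.pos_denom x).ne']

theorem hasDerivAt_ramp (s : ℝ) : HasDerivAt ramp (Real.smoothTransition (2 * s + 1 / 2)) s := by
  have hc : Continuous fun u : ℝ => Real.smoothTransition (2 * u + 1 / 2) :=
    Real.smoothTransition.continuous.comp (by fun_prop)
  exact intervalIntegral.integral_hasDerivAt_right (hc.intervalIntegrable _ _)
    (hc.stronglyMeasurableAtFilter _ _) hc.continuousAt

theorem contDiff_ramp : ContDiff ℝ ∞ ramp := by
  rw [contDiff_infty_iff_deriv]
  refine ⟨fun s => (hasDerivAt_ramp s).differentiableAt, ?_⟩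
  rw [funext fun s => (hasDerivAt_ramp s).deriv]
  exact Real.smoothTransition.contDiff.comp (by fun_prop)

theorem ramp_of_le {s : ℝ} (hs : s ≤ -(1 / 4)) : ramp s = 0 := by
  unfold ramp
  rw [intervalIntegral.integral_symm, intervalIntegral.integral_zero_ae, neg_zero]
  refine Filter.Eventually.of_forall fun u hu => ?_
  rw [Set.uIoc_of_le hs] at hu
  exact Real.smoothTransition.zero_of_nonpos (by linarith [hu.2])

theorem ramp_neg (s : ℝ) : ramp (-s) = ramp s - s := by
  have hd : ∀ x, HasDerivAt (fun s => ramp s - s - ramp (-s)) 0 x := fun x => by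
    have h := ((hasDerivAt_ramp x).sub (hasDerivAt_id x)).sub
      ((hasDerivAt_ramp (-x)).comp x (hasDerivAt_neg x))
    have hsum := smoothTransition_add_one_sub (2 * x + 1 / 2)
    rw [show 1 - (2 * x + 1 / 2) = 2 * -x + 1 / 2 by ring] at hsum
    exact h.congr_deriv (by linarith)
  have hconst :=
    is_const_of_deriv_eq_zero (fun x => (hd x).differentiableAt) (fun x => (hd x).deriv) s 0
  simp only [sub_zero, neg_zero, sub_self] at hconst
  linarith

theorem ramp_of_ge {s : ℝ} (hs : 1 / 4 ≤ s) : ramp s = s := by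
  have h := ramp_neg s
  rw [ramp_of_le (by linarith)] at h
  linarith

theorem monotone_ramp : Monotone ramp :=
  monotone_of_deriv_nonneg (fun s => (hasDerivAt_ramp s).differentiableAt) fun s => by
    rw [(hasDerivAt_ramp s).deriv]; exact Real.smoothTransition.nonneg _

theorem ramp_nonneg (s : ℝ) : 0 ≤ ramp s := by
  rcases le_total s (-(1 / 4)) with h | h
  · rw [ramp_of_le h]
  · exact (ramp_of_le le_rfl).ge.trans (monotone_ramp h)

theorem ramp_add_ramp_neg_le {s r : ℝ} (hs : |s| ≤ r) (hr : 1 / 4 ≤ r) :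
    ramp s + ramp (-s) ≤ r := by
  wlog h0 : 0 ≤ s generalizing s
  · have h := this (s := -s) (by rwa [abs_neg]) (by linarith)
    rwa [neg_neg, add_comm] at h
  have hd : ∀ x, HasDerivAt (fun s => ramp s + ramp s - s)
      (Real.smoothTransition (2 * x + 1 / 2) + Real.smoothTransition (2 * x + 1 / 2) - 1) x :=
    fun x => ((hasDerivAt_ramp x).add (hasDerivAt_ramp x)).sub (hasDerivAt_id x)
  have hmono : MonotoneOn (fun s => ramp s + ramp s - s) (Set.Ici 0) := by
    refine monotoneOn_of_deriv_nonneg (convex_Ici 0)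
      (fun x _ => (hd x).continuousAt.continuousWithinAt)
      (fun x _ => (hd x).differentiableAt.differentiableWithinAt) fun x hx => ?_
    rw [interior_Ici, Set.mem_Ioi] at hx
    have h_le : Real.smoothTransition (1 - (2 * x + 1 / 2)) ≤
        Real.smoothTransition (2 * x + 1 / 2) :=
      Real.smoothTransition.monotone (by linarith)
    rw [(hd x).deriv]
    linarith [smoothTransition_add_one_sub (2 * x + 1 / 2)]
  have h_le_r := hmono h0 (show (0 : ℝ) ≤ r by linarith) ((le_abs_self s).trans hs)
  simp only [ramp_of_ge hr] at h_le_r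
  linarith [ramp_neg s]

/-! ### Knots glued from the strands of a string link and four arcs -/

/-- The passage `i : Fin 4` of the knot through the string links lies in the left-hand cylinder
(`0`) or in the right-hand cylinder (`1`). -/
def passageSide : Fin 4 → Fin 2 := ![0, 1, 0, 1]

/-- The strand of `J` that the knot follows in its `i`-th passage. -/
def passageStrand : Fin 4 → Fin 2 := ![0, 1, 1, 0]

/-- The knot runs upwards in the first two passages and downwards in the last two. -/
def passageTime (i : Fin 4) (τ : ℝ) : ℝ := if i < 2 then τ else 1 - τ

/-- The base points of the cylinders, the left-hand one at height `h` and the right-hand one at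
height `-h`. -/
def cylinderBase (h : ℝ) : Fin 2 → R3 := ![!₂[-4, 0, h], !₂[4, 0, -h]]

/-- The identification of the two copies of the string link with `J`: the right-hand copy is
`f(J̄)`. -/
def cylinderSymm : Fin 2 → R3 → R3 := ![id, fun p => flipMap (mirrorMap p)]

/-- The `i`-th passage of the knot through the two cylinders at heights `h` and `-h`, in the order
in which the knot runs through them. -/
def linkPiece (J : StringLink) (h : ℝ) (i : Fin 4) (τ : ℝ) : R3 :=
  cylinderBase h (passageSide i) +
    cylinderSymm (passageSide i) (J.strand (passageStrand i) (passageTime i τ))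

theorem cylinderSymm_involutive (k : Fin 2) : Function.Involutive (cylinderSymm k) := fun p => by
  ext i; fin_cases k <;> fin_cases i <;> simp [cylinderSymm, flipMap, mirrorMap]

theorem contDiff_cylinderSymm (k : Fin 2) : ContDiff ℝ ∞ (cylinderSymm k) := by
  fin_cases k
  · exact contDiff_id
  · exact contDiff_flipMap.comp contDiff_mirrorMap

theorem contDiff_passageTime (i : Fin 4) : ContDiff ℝ ∞ (passageTime i) := by
  unfold passageTime
  split_ifs <;> fun_prop

theorem passageTime_mem_Icc (i : Fin 4) {τ : ℝ} (hτ : τ ∈ Set.Icc (0 : ℝ) 1) :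
    passageTime i τ ∈ Set.Icc (0 : ℝ) 1 := by
  unfold passageTime
  split_ifs
  · exact hτ
  · exact ⟨by linarith [hτ.2], by linarith [hτ.1]⟩

theorem contDiff_linkPiece (J : StringLink) (h : ℝ) (i : Fin 4) :
    ContDiff ℝ ∞ (linkPiece J h i) :=
  contDiff_const.add
    ((contDiff_cylinderSymm _).comp ((J.smooth _).comp (contDiff_passageTime i)))

theorem deriv_linkPiece_ne_zero (J : StringLink) (h : ℝ) (i : Fin 4) (τ : ℝ) :
    deriv (linkPiece J h i) τ ≠ 0 := by
  have hd := (contDiff_cylinderSymm (passageSide i)).differentiable (by simp)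
  unfold linkPiece
  rw [deriv_const_add]
  refine deriv_comp_ne_zero_of_leftInverse hd hd (cylinderSymm_involutive _).leftInverse ?_
  unfold passageTime
  split_ifs
  · exact J.immersion _ _
  · rw [deriv_comp_const_sub]
    exact neg_ne_zero.2 (J.immersion _ _)

/-- The box circumscribed about the left-hand (`0`) or right-hand (`1`) cylinder. -/
def cylinderBox (h : ℝ) (k : Fin 2) : Set R3 :=
  {p | |p 0 - cylinderBase h k 0| ≤ 1 ∧ p 1 ∈ Set.Icc 0 1 ∧ |p 2 - cylinderBase h k 2| ≤ 1}

theorem StringLink.strand_bounds (J : StringLink) (i : Fin 2) {t : ℝ}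
    (ht : t ∈ Set.Icc (0 : ℝ) 1) :
    |J.strand i t 0| ≤ 1 ∧ J.strand i t 1 ∈ Set.Icc 0 1 ∧ |J.strand i t 2| ≤ 1 := by
  by_cases h : t ≤ 0 ∨ 1 ≤ t
  · rw [J.vertical i t h]
    refine ⟨?_, ht, by simp⟩
    fin_cases i <;> norm_num [basePoint, abs_le]
  · push Not at h
    obtain ⟨h_disk, h_height⟩ := J.inside i t ⟨h.1, h.2⟩
    refine ⟨?_, ⟨h_height.1.le, h_height.2.le⟩, ?_⟩ <;> rw [← sq_le_one_iff_abs_le_one]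
    · linarith [sq_nonneg (J.strand i t 2)]
    · linarith [sq_nonneg (J.strand i t 0)]

theorem linkPiece_mem_cylinderBox (J : StringLink) (h : ℝ) (i : Fin 4) {τ : ℝ}
    (hτ : τ ∈ Set.Icc (0 : ℝ) 1) : linkPiece J h i τ ∈ cylinderBox h (passageSide i) := by
  obtain ⟨hx, hy, hz⟩ := J.strand_bounds (passageStrand i) (passageTime_mem_Icc i hτ)
  unfold linkPiece
  rcases Fin.exists_fin_two.1 ⟨passageSide i, rfl⟩ with hk | hk <;> rw [hk] <;>
    simpa [cylinderBox, cylinderBase, cylinderSymm, flipMap, mirrorMap] using ⟨hx, hy, hz⟩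

theorem linkPiece_notMem_cylinderBox (J : StringLink) (h : ℝ) (i : Fin 4) {τ : ℝ}
    (hτ : τ < 0 ∨ 1 < τ) (k : Fin 2) : linkPiece J h i τ ∉ cylinderBox h k := by
  have h_time : passageTime i τ < 0 ∨ 1 < passageTime i τ := by
    unfold passageTime
    split_ifs
    · exact hτ
    · exact hτ.symm.imp (fun _ => by linarith) fun _ => by linarith
  have h_height : linkPiece J h i τ 1 = passageTime i τ := by
    unfold linkPiece
    rw [J.vertical _ _ (h_time.imp le_of_lt le_of_lt)]
    rcases Fin.exists_fin_two.1 ⟨passageSide i, rfl⟩ with hk | hk <;> rw [hk] <;>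
      simp [cylinderBase, cylinderSymm, flipMap, mirrorMap]
  rintro ⟨-, ⟨h0, h1⟩, -⟩
  rw [h_height] at h0 h1
  rcases h_time with h | h <;> linarith

theorem cylinderBox_side_unique {h : ℝ} {k l : Fin 2} {p : R3} (hk : p ∈ cylinderBox h k)
    (hl : p ∈ cylinderBox h l) : k = l := by
  have hk := abs_le.1 hk.1
  have hl := abs_le.1 hl.1
  revert hk hl
  fin_cases k <;> fin_cases l <;> norm_num [cylinderBase] <;> intros <;> linarith

theorem linkPiece_injective (J : StringLink) (h : ℝ) {i j : Fin 4} {τ τ' : ℝ}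
    (hτ : τ ∈ Set.Icc (0 : ℝ) 1) (hτ' : τ' ∈ Set.Icc (0 : ℝ) 1)
    (he : linkPiece J h i τ = linkPiece J h j τ') : i = j ∧ τ = τ' := by
  have h_side : passageSide i = passageSide j :=
    cylinderBox_side_unique (linkPiece_mem_cylinderBox J h i hτ)
      (he ▸ linkPiece_mem_cylinderBox J h j hτ')
  unfold linkPiece at he
  rw [h_side] at he
  obtain ⟨h_strand, h_time⟩ := J.injective _ _ _ _
    ((cylinderSymm_involutive _).injective (add_left_cancel he))
  have hij : i = j :=
    (by decide : ∀ i j, passageSide i = passageSide j → passageStrand i = passageStrand j → i = j)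
      i j h_side h_strand
  subst hij
  unfold passageTime at h_time
  split_ifs at h_time
  · exact ⟨rfl, h_time⟩
  · exact ⟨rfl, by linarith⟩

/-- The arcs continue the vertical ends of the strands. -/
structure Fits (J : StringLink) (h : ℝ) (a : Fin 4 → ℝ → R3) : Prop where
  start : ∀ i s, 0 ≤ s → s ≤ 1 / 4 → a i s = linkPiece J h i (1 + s)
  finish : ∀ i s, 19 / 4 ≤ s → s ≤ 5 → a i s = linkPiece J h (i + 1) (s - 5)

/-- The closed curve `γ` runs through the four strands and the arcs `a 0, …, a 3`; each strand takes
one and each arc five of the `24` units of time. -/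
structure Decomposes (J : StringLink) (γ : ℝ → R3) (h : ℝ) (a : Fin 4 → ℝ → R3) : Prop where
  periodic : ∀ s, γ (s + 1) = γ s
  on_piece : ∀ i : Fin 4, ∀ τ ∈ Set.Icc (-(1 / 4) : ℝ) (5 / 4),
    γ ((6 * (i : ℕ) + τ) / 24) = linkPiece J h i τ
  on_arc : ∀ i : Fin 4, ∀ s ∈ Set.Icc (0 : ℝ) 5, γ ((6 * (i : ℕ) + 1 + s) / 24) = a i s
  smooth_arc : ∀ i, ContDiff ℝ ∞ (a i)

/-- A strand followed by the next arc. -/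
def blockCurve (J : StringLink) (h : ℝ) (a : Fin 4 → ℝ → R3) (i : Fin 4) (v : ℝ) : R3 :=
  if v < 1 then linkPiece J h i v else a i (v - 1)

/-- The closed curve made of the four strands and the arcs `a 0, …, a 3`. -/
def closedCurve (J : StringLink) (h : ℝ) (a : Fin 4 → ℝ → R3) (s : ℝ) : R3 :=
  blockCurve J h a (Fin.ofNat 4 ⌊4 * Int.fract s⌋₊) (6 * Int.fract (4 * Int.fract s))

theorem closedCurve_block (J : StringLink) (h : ℝ) (a : Fin 4 → ℝ → R3) (i : Fin 4) {v : ℝ}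
    (hv : v ∈ Set.Ico (0 : ℝ) 6) :
    closedCurve J h a ((6 * (i : ℕ) + v) / 24) = blockCurve J h a i v := by
  have hi : ((i : ℕ) : ℝ) ≤ 3 := by exact_mod_cast Nat.le_of_lt_succ i.2
  have h_fract : Int.fract ((6 * (i : ℕ) + v) / 24) = (6 * (i : ℕ) + v) / 24 :=
    Int.fract_eq_self.2 ⟨by have := hv.1; positivity, by linarith [hv.2]⟩
  have h_mul : 4 * ((6 * ((i : ℕ) : ℝ) + v) / 24) = (i : ℕ) + v / 6 := by ring
  have hv6 : v / 6 ∈ Set.Ico (0 : ℝ) 1 := ⟨by linarith [hv.1], by linarith [hv.2]⟩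
  have h_floor : ⌊((i : ℕ) : ℝ) + v / 6⌋₊ = i :=
    (Nat.floor_eq_iff (by linarith [hv6.1, Nat.cast_nonneg (α := ℝ) (i : ℕ)])).2
      ⟨by linarith [hv6.1], by linarith [hv6.2]⟩
  rw [closedCurve, h_fract, h_mul, h_floor, Int.fract_natCast_add, Int.fract_eq_self.2 hv6,
    Fin.ofNat_val_eq_self, mul_div_cancel₀ v (by norm_num : (6 : ℝ) ≠ 0)]

theorem apply_block_succ {α : Type*} {γ : ℝ → α} (hγ : ∀ s, γ (s + 1) = γ s) (i : Fin 4) (v : ℝ) :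
    γ ((6 * ((i + 1 : Fin 4) : ℕ) + v) / 24) = γ ((6 * (i : ℕ) + (v + 6)) / 24) := by
  rw [Fin.val_add_one]
  split_ifs with hi
  · rw [hi, ← hγ, Fin.val_last]
    congr 1
    push_cast
    ring
  · congr 1
    push_cast
    ring

theorem Decomposes.of_blocks {J : StringLink} {γ : ℝ → R3} {h : ℝ} {a : Fin 4 → ℝ → R3}
    (hγ : ∀ s, γ (s + 1) = γ s)
    (hblock : ∀ i : Fin 4, ∀ v ∈ Set.Ico (0 : ℝ) 6,
      γ ((6 * (i : ℕ) + v) / 24) = blockCurve J h a i v)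
    (hf : Fits J h a) (ha : ∀ i, ContDiff ℝ ∞ (a i)) : Decomposes J γ h a where
  periodic := hγ
  on_piece i τ hτ := by
    obtain ⟨hτ0, hτ1⟩ := hτ
    rcases lt_or_ge τ 0 with hτ_neg | hτ_nonneg
    · obtain ⟨j, rfl⟩ : ∃ j, i = j + 1 := ⟨i - 1, (sub_add_cancel i 1).symm⟩
      rw [apply_block_succ hγ, hblock j _ ⟨by linarith, by linarith⟩, blockCurve,
        if_neg (by linarith), hf.finish j _ (by linarith) (by linarith)]
      congr 1
      ring
    · rw [hblock i τ ⟨hτ_nonneg, by linarith⟩, blockCurve]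
      split_ifs with h_lt
      · rfl
      · rw [hf.start i _ (by linarith) (by linarith), add_sub_cancel]
  on_arc i s hs := by
    rcases hs.2.lt_or_eq with h_lt | rfl
    · rw [add_assoc, hblock i _ ⟨by linarith [hs.1], by linarith⟩, blockCurve,
        if_neg (by linarith [hs.1]), add_sub_cancel_left]
    · have h_next := apply_block_succ hγ i 0
      rw [hblock (i + 1) 0 (by norm_num), blockCurve, if_pos one_pos] at h_next
      rw [hf.finish i 5 (by norm_num) le_rfl, sub_self, h_next]
      congr 1
      ring
  smooth_arc := ha

theorem Fits.decomposes_closedCurve {J : StringLink} {h : ℝ} {a : Fin 4 → ℝ → R3}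
    (hf : Fits J h a) (ha : ∀ i, ContDiff ℝ ∞ (a i)) : Decomposes J (closedCurve J h a) h a :=
  .of_blocks (fun s => by rw [closedCurve, closedCurve, Int.fract_add_one])
    (fun i _ hv => closedCurve_block J h a i hv) hf ha

/-- The time elapsed since the beginning of the `i`-th block of the `n`-th period, where one
period is `24` units. -/
def blockTime (n : ℤ) (i : Fin 4) (s : ℝ) : ℝ := 24 * (s - n) - 6 * (i : ℕ)

theorem eq_add_int_of_blockTime_eq {n n' : ℤ} {i : Fin 4} {s s' : ℝ}
    (h : blockTime n i s = blockTime n' i s') : ∃ m : ℤ, s = s' + m :=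
  ⟨n - n', by unfold blockTime at h; push_cast; linarith⟩

theorem contDiff_blockTime (n : ℤ) (i : Fin 4) : ContDiff ℝ ∞ (blockTime n i) := by
  unfold blockTime
  fun_prop

theorem hasDerivAt_blockTime (n : ℤ) (i : Fin 4) (s : ℝ) : HasDerivAt (blockTime n i) 24 s :=
  ((((hasDerivAt_id s).sub_const (n : ℝ)).const_mul 24).sub_const _).congr_deriv (mul_one 24)

theorem exists_blockTime_mem_Ico (s : ℝ) :
    ∃ (n : ℤ) (i : Fin 4), blockTime n i s ∈ Set.Ico (0 : ℝ) 6 := by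
  have h_nonneg : 0 ≤ 4 * Int.fract s := by linarith [Int.fract_nonneg s]
  have h_lt : ⌊4 * Int.fract s⌋₊ < 4 :=
    (Nat.floor_lt h_nonneg).2 (by push_cast; linarith [Int.fract_lt_one s])
  have h_le := Nat.floor_le h_nonneg
  have h_lt_add := Nat.lt_floor_add_one (4 * Int.fract s)
  refine ⟨⌊s⌋, ⟨_, h_lt⟩, ?_⟩
  unfold blockTime
  rw [Int.self_sub_floor]
  constructor <;> linarith

namespace Decomposes

variable {J : StringLink} {γ : ℝ → R3} {h : ℝ} {a : Fin 4 → ℝ → R3}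

theorem apply_of_blockTime (hd : Decomposes J γ h a) (n : ℤ) (i : Fin 4) (s : ℝ) :
    γ s = γ ((6 * (i : ℕ) + blockTime n i s) / 24) := by
  have hp : Function.Periodic γ 1 := hd.periodic
  rw [← hp.sub_int_mul_eq n (x := s)]
  unfold blockTime
  congr 1
  ring

theorem eventuallyEq (hd : Decomposes J γ h a) (s : ℝ) : ∃ (n : ℤ) (i : Fin 4),
    (blockTime n i s ∈ Set.Icc (0 : ℝ) 1 ∧
      γ =ᶠ[nhds s] fun s' => linkPiece J h i (blockTime n i s')) ∨
    (blockTime n i s - 1 ∈ Set.Ioo (0 : ℝ) 5 ∧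
      γ =ᶠ[nhds s] fun s' => a i (blockTime n i s' - 1)) := by
  obtain ⟨n, i, h0, h6⟩ := exists_blockTime_mem_Ico s
  have hc := (contDiff_blockTime n i).continuous.continuousAt (x := s)
  refine ⟨n, i, (le_or_gt (blockTime n i s) 1).imp (fun h1 => ⟨⟨h0, h1⟩, ?_⟩)
    fun h1 => ⟨⟨by linarith, by linarith⟩, ?_⟩⟩
  · filter_upwards [hc.eventually (Icc_mem_nhds (a := -(1 / 4)) (b := 5 / 4) (by linarith)
      (by linarith))] with s' hs'
    rw [hd.apply_of_blockTime n i s', hd.on_piece i _ hs']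
  · filter_upwards [hc.eventually (Icc_mem_nhds h1 h6)] with s' hs'
    rw [hd.apply_of_blockTime n i s',
      ← hd.on_arc i _ ⟨by linarith [hs'.1], by linarith [hs'.2]⟩, add_assoc, add_sub_cancel]

theorem arc_start (hd : Decomposes J γ h a) (i : Fin 4) {s : ℝ}
    (hs : s ∈ Set.Icc (0 : ℝ) (1 / 4)) : a i s = linkPiece J h i (1 + s) := by
  rw [← hd.on_arc i s ⟨hs.1, by linarith [hs.2]⟩,
    ← hd.on_piece i (1 + s) ⟨by linarith [hs.1], by linarith [hs.2]⟩, add_assoc]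

theorem arc_finish (hd : Decomposes J γ h a) (i : Fin 4) {s : ℝ}
    (hs : s ∈ Set.Icc (19 / 4 : ℝ) 5) : a i s = linkPiece J h (i + 1) (s - 5) := by
  rw [← hd.on_arc i s ⟨by linarith [hs.1], hs.2⟩,
    ← hd.on_piece (i + 1) (s - 5) ⟨by linarith [hs.1], by linarith [hs.2]⟩,
    apply_block_succ hd.periodic]
  congr 1
  ring

theorem contDiff (hd : Decomposes J γ h a) : ContDiff ℝ ∞ γ := by
  refine contDiff_iff_contDiffAt.2 fun s => ?_
  obtain ⟨n, i, ⟨-, he⟩ | ⟨-, he⟩⟩ := hd.eventuallyEq s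
  · exact ((contDiff_linkPiece J h i).comp
      (contDiff_blockTime n i)).contDiffAt.congr_of_eventuallyEq he
  · exact ((hd.smooth_arc i).comp
      ((contDiff_blockTime n i).sub contDiff_const)).contDiffAt.congr_of_eventuallyEq he

theorem deriv_ne_zero (hd : Decomposes J γ h a)
    (himm : ∀ i, ∀ s ∈ Set.Ioo (0 : ℝ) 5, deriv (a i) s ≠ 0) (s : ℝ) : deriv γ s ≠ 0 := by
  obtain ⟨n, i, ⟨-, he⟩ | ⟨hs, he⟩⟩ := hd.eventuallyEq s <;> rw [he.deriv_eq]
  · have hf := ((contDiff_linkPiece J h i).differentiable (by simp) (blockTime n i s)).hasDerivAt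
    exact (hf.scomp s (hasDerivAt_blockTime n i s)).deriv.trans_ne
      (smul_ne_zero (by norm_num) (deriv_linkPiece_ne_zero J h i _))
  · have hf := ((hd.smooth_arc i).differentiable (by simp) (blockTime n i s - 1)).hasDerivAt
    exact (hf.scomp s ((hasDerivAt_blockTime n i s).sub_const 1)).deriv.trans_ne
      (smul_ne_zero (by norm_num) (himm i _ hs))

theorem isKnot (hd : Decomposes J γ h a)
    (himm : ∀ i, ∀ s ∈ Set.Ioo (0 : ℝ) 5, deriv (a i) s ≠ 0)
    (hinj : ∀ i j, ∀ s ∈ Set.Ioo (0 : ℝ) 5, ∀ s' ∈ Set.Ioo (0 : ℝ) 5,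
      a i s = a j s' → i = j ∧ s = s')
    (hbox : ∀ i k, ∀ s ∈ Set.Ioo (0 : ℝ) 5, a i s ∉ cylinderBox h k) : IsKnot γ where
  smooth := hd.contDiff
  periodic := hd.periodic
  immersion := hd.deriv_ne_zero himm
  injective s t hst := by
    obtain ⟨n, i, ⟨hs, he⟩ | ⟨hs, he⟩⟩ := hd.eventuallyEq s <;>
    obtain ⟨n', i', ⟨ht, he'⟩ | ⟨ht, he'⟩⟩ := hd.eventuallyEq t <;>
    rw [he.eq_of_nhds, he'.eq_of_nhds] at hst
    · obtain ⟨rfl, h_time⟩ := linkPiece_injective J h hs ht hst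
      exact eq_add_int_of_blockTime_eq h_time
    · exact absurd (hst ▸ linkPiece_mem_cylinderBox J h i hs) (hbox i' _ _ ht)
    · exact absurd (hst ▸ linkPiece_mem_cylinderBox J h i' ht) (hbox i _ _ hs)
    · obtain ⟨rfl, h_time⟩ := hinj i i' _ hs _ ht hst
      exact eq_add_int_of_blockTime_eq (sub_left_injective h_time)

end Decomposes

/-- Stage `t` of the straight-line homotopy from `f` to `g`. -/
def blend (t : ℝ) (f g : ℝ → R3) (s : ℝ) : R3 := (1 - t) • f s + t • g s

theorem blend_zero (f g : ℝ → R3) : blend 0 f g = f := by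
  funext s
  simp [blend]

theorem blend_one (f g : ℝ → R3) : blend 1 f g = g := by
  funext s
  simp [blend]

theorem contDiff_blend (t : ℝ) {f g : ℝ → R3} (hf : ContDiff ℝ ∞ f) (hg : ContDiff ℝ ∞ g) :
    ContDiff ℝ ∞ (blend t f g) :=
  (hf.const_smul (1 - t)).add (hg.const_smul t)

theorem cylinderBase_blend (h₀ h₁ t : ℝ) (k : Fin 2) :
    cylinderBase ((1 - t) * h₀ + t * h₁) k =
      (1 - t) • cylinderBase h₀ k + t • cylinderBase h₁ k := by
  ext c
  fin_cases k <;> fin_cases c <;> simp [cylinderBase] <;> ring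

theorem blend_linkPiece (J : StringLink) (h₀ h₁ t : ℝ) (i : Fin 4) (τ : ℝ) :
    blend t (linkPiece J h₀ i) (linkPiece J h₁ i) τ =
      linkPiece J ((1 - t) * h₀ + t * h₁) i τ := by
  unfold blend linkPiece
  rw [cylinderBase_blend]
  module

theorem exists_blend_of_mem_cylinderBox {h₀ h₁ t : ℝ} {k : Fin 2} {p : R3}
    (hp : p ∈ cylinderBox ((1 - t) * h₀ + t * h₁) k) :
    ∃ q₀ ∈ cylinderBox h₀ k, ∃ q₁ ∈ cylinderBox h₁ k, (1 - t) • q₀ + t • q₁ = p := by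
  have translate_mem : ∀ h, p - cylinderBase ((1 - t) * h₀ + t * h₁) k + cylinderBase h k ∈
      cylinderBox h k := fun h => by
    have h_base : ∀ b, cylinderBase b k 1 = 0 := fun b => by fin_cases k <;> simp [cylinderBase]
    obtain ⟨hx, hy, hz⟩ := hp
    refine ⟨?_, ?_, ?_⟩ <;> simpa [h_base]
  refine ⟨_, translate_mem h₀, _, translate_mem h₁, ?_⟩
  rw [cylinderBase_blend]
  module

theorem Decomposes.blend {J : StringLink} {γ₀ γ₁ : ℝ → R3} {h₀ h₁ : ℝ}
    {a₀ a₁ : Fin 4 → ℝ → R3} (hd₀ : Decomposes J γ₀ h₀ a₀) (hd₁ : Decomposes J γ₁ h₁ a₁) (t : ℝ) :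
    Decomposes J (blend t γ₀ γ₁) ((1 - t) * h₀ + t * h₁) (fun i => blend t (a₀ i) (a₁ i)) where
  periodic s := by simp only [_root_.blend, hd₀.periodic, hd₁.periodic]
  on_piece i τ hτ := by
    rw [← blend_linkPiece]
    simp only [_root_.blend, hd₀.on_piece i τ hτ, hd₁.on_piece i τ hτ]
  on_arc i s hs := by simp only [_root_.blend, hd₀.on_arc i s hs, hd₁.on_arc i s hs]
  smooth_arc i := contDiff_blend t (hd₀.smooth_arc i) (hd₁.smooth_arc i)

/-! ### Certified straight-line isotopies -/

/-- Integer vectors, used both as points (in units of `1/24`) and as linear functionals. -/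
abbrev IntVec : Type := ℤ × ℤ × ℤ

/-- The dot product of integer vectors. -/
def intDot (c p : IntVec) : ℤ := c.1 * p.1 + c.2.1 * p.2.1 + c.2.2 * p.2.2

/-- The linear functional on `ℝ³` with integer coefficients `c`. -/
def pairing (c : IntVec) : R3 →L[ℝ] ℝ :=
  (c.1 : ℝ) • (EuclideanSpace.proj 0 : R3 →L[ℝ] ℝ) + (c.2.1 : ℝ) • EuclideanSpace.proj 1
    + (c.2.2 : ℝ) • EuclideanSpace.proj 2

theorem pairing_apply (c : IntVec) (p : R3) :
    pairing c p = c.1 * p 0 + c.2.1 * p 1 + c.2.2 * p 2 := by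
  simp [pairing]

theorem pairing_neg (c : IntVec) (p : R3) : pairing (-c) p = -pairing c p := by
  simp only [pairing_apply, Prod.fst_neg, Prod.snd_neg, Int.cast_neg]
  ring

theorem intDot_neg (c p : IntVec) : intDot (-c) p = -intDot c p := by
  simp only [intDot, Prod.fst_neg, Prod.snd_neg]
  ring

/-- The point `24 • p` lies in the convex hull of `H`. This is tested on integer functionals only,
which is all that is needed to separate two such hulls. -/
def InHull (H : List IntVec) (p : R3) : Prop :=
  ∀ c : IntVec, ∃ q ∈ H, (intDot c q : ℝ) ≤ 24 * pairing c p

/-- The vector `v` is nonzero and lies in the convex cone spanned by `V`, if some functional is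
positive on `V`. Again this is tested on integer functionals only. -/
def InCone (V : List IntVec) (v : R3) : Prop :=
  ∀ c : IntVec, (∀ q ∈ V, 0 < intDot c q) → 0 < pairing c v

theorem InHull.pairing_lt {H H' : List IntVec} {x y : R3} (hx : InHull H x) (hy : InHull H' y)
    {c : IntVec} (h : ∀ p ∈ H, ∀ q ∈ H', intDot c p < intDot c q) :
    pairing c x < pairing c y := by
  obtain ⟨p, hp, hpx⟩ := hx (-c)
  obtain ⟨q, hq, hqy⟩ := hy c
  have hpq : (intDot c p : ℝ) < intDot c q := Int.cast_lt.2 (h p hp q hq)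
  rw [intDot_neg, pairing_neg] at hpx
  push_cast at hpx
  linarith

/-- The vertices of an axis-parallel box. -/
def boxHull (lo hi : IntVec) : List IntVec :=
  [(lo.1, lo.2.1, lo.2.2), (lo.1, lo.2.1, hi.2.2), (lo.1, hi.2.1, lo.2.2), (lo.1, hi.2.1, hi.2.2),
    (hi.1, lo.2.1, lo.2.2), (hi.1, lo.2.1, hi.2.2), (hi.1, hi.2.1, lo.2.2), (hi.1, hi.2.1, hi.2.2)]

theorem mem_boxHull {lo hi : IntVec} {x y z : ℤ} (hx : x = lo.1 ∨ x = hi.1)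
    (hy : y = lo.2.1 ∨ y = hi.2.1) (hz : z = lo.2.2 ∨ z = hi.2.2) :
    (x, y, z) ∈ boxHull lo hi := by
  rcases hx with rfl | rfl <;> rcases hy with rfl | rfl <;> rcases hz with rfl | rfl <;>
    simp [boxHull]

theorem inHull_boxHull {lo hi : IntVec} {p : R3} (hx : 24 * p 0 ∈ Set.Icc (lo.1 : ℝ) hi.1)
    (hy : 24 * p 1 ∈ Set.Icc (lo.2.1 : ℝ) hi.2.1) (hz : 24 * p 2 ∈ Set.Icc (lo.2.2 : ℝ) hi.2.2) :
    InHull (boxHull lo hi) p := by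
  have exists_end : ∀ (e l u : ℤ) (x : ℝ), x ∈ Set.Icc (l : ℝ) u →
      ∃ m, (m = l ∨ m = u) ∧ (e : ℝ) * m ≤ e * x := fun e l u x hx => by
    rcases le_total (0 : ℝ) e with he | he
    · exact ⟨l, .inl rfl, mul_le_mul_of_nonneg_left hx.1 he⟩
    · exact ⟨u, .inr rfl, mul_le_mul_of_nonpos_left hx.2 he⟩
  intro c
  obtain ⟨x, hx_end, hx_le⟩ := exists_end c.1 _ _ _ hx
  obtain ⟨y, hy_end, hy_le⟩ := exists_end c.2.1 _ _ _ hy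
  obtain ⟨z, hz_end, hz_le⟩ := exists_end c.2.2 _ _ _ hz
  refine ⟨(x, y, z), mem_boxHull hx_end hy_end hz_end, ?_⟩
  rw [pairing_apply, intDot]
  push_cast
  linarith

/-- The boxes about the cylinders at heights `h` and `-h`, in units of `1/24`. -/
def cylinderHull (h : ℤ) : Fin 2 → List IntVec :=
  ![boxHull (-120, 0, 24 * h - 24) (-72, 24, 24 * h + 24),
    boxHull (72, 0, -24 * h - 24) (120, 24, -24 * h + 24)]

theorem inHull_cylinderHull (h : ℤ) {k : Fin 2} {p : R3} (hp : p ∈ cylinderBox h k) :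
    InHull (cylinderHull h k) p := by
  obtain ⟨hx, ⟨hy0, hy1⟩, hz⟩ := hp
  obtain ⟨hx0, hx1⟩ := abs_le.1 hx
  obtain ⟨hz0, hz1⟩ := abs_le.1 hz
  revert hx0 hx1 hz0 hz1
  fin_cases k <;> simp only [cylinderBase, cylinderHull, Fin.zero_eta, Fin.mk_one,
    Matrix.cons_val] <;> intros <;> apply inHull_boxHull <;> push_cast <;> constructor <;> linarith

/-- Some functional in `F` separates `H₀` from `H₀'` and `H₁` from `H₁'`. -/
def Separated (F H₀ H₁ H₀' H₁' : List IntVec) : Prop :=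
  ∃ c ∈ F, (∀ p ∈ H₀, ∀ q ∈ H₀', intDot c p < intDot c q) ∧
    ∀ p ∈ H₁, ∀ q ∈ H₁', intDot c p < intDot c q

instance (F H₀ H₁ H₀' H₁' : List IntVec) : Decidable (Separated F H₀ H₁ H₀' H₁') := by
  unfold Separated; infer_instance

theorem convexCombo_pos {t x y : ℝ} (ht : t ∈ Set.Icc (0 : ℝ) 1) (hx : 0 < x) (hy : 0 < y) :
    0 < (1 - t) * x + t * y :=
  convex_Ioi (0 : ℝ) hx hy (sub_nonneg.2 ht.2) ht.1 (sub_add_cancel 1 t)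

theorem Separated.convexCombo_ne {F H₀ H₁ H₀' H₁' : List IntVec}
    (h : Separated F H₀ H₁ H₀' H₁') {x₀ x₁ y₀ y₁ : R3} (hx₀ : InHull H₀ x₀) (hx₁ : InHull H₁ x₁)
    (hy₀ : InHull H₀' y₀) (hy₁ : InHull H₁' y₁) {t : ℝ} (ht : t ∈ Set.Icc (0 : ℝ) 1) :
    (1 - t) • x₀ + t • x₁ ≠ (1 - t) • y₀ + t • y₁ := by
  obtain ⟨c, -, h₀, h₁⟩ := h
  intro he
  have h_eq := congrArg (pairing c) he
  simp only [map_add, map_smul, smul_eq_mul] at h_eq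
  linarith [convexCombo_pos ht (sub_pos.2 (hx₀.pairing_lt hy₀ h₀))
    (sub_pos.2 (hx₁.pairing_lt hy₁ h₁))]

/-- Some functional in `F` is positive on all given vectors. -/
def HasCommonDirection (F V : List IntVec) : Prop := ∃ c ∈ F, ∀ v ∈ V, 0 < intDot c v

instance (F V : List IntVec) : Decidable (HasCommonDirection F V) := by
  unfold HasCommonDirection; infer_instance

/-- Bounds for a piece of a curve: its position lies in the hull of `hull`, its velocity in the cone
over `vel`. -/
structure Piece where
  hull : List IntVec
  vel : List IntVec

/-- The times `s ∈ [0, 5]` with `k/2 - 1/4 ≤ s ≤ k/2 + 1/4`. -/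
def pieceWindow (k : ℕ) : Set ℝ := {s ∈ Set.Icc (0 : ℝ) 5 | |2 * s - k| ≤ 1 / 2}

theorem exists_mem_pieceWindow {s : ℝ} (hs : s ∈ Set.Icc (0 : ℝ) 5) :
    ∃ k : Fin 11, s ∈ pieceWindow k := by
  have h0 : (0 : ℝ) ≤ 2 * s + 1 / 2 := by linarith [hs.1]
  have h_le := Nat.floor_le h0
  have h_lt := Nat.lt_floor_add_one (2 * s + 1 / 2)
  refine ⟨⟨⌊2 * s + 1 / 2⌋₊, (Nat.floor_lt h0).2 ?_⟩, hs, abs_le.2 ⟨?_, ?_⟩⟩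
  · push_cast
    linarith [hs.2]
  · linarith
  · linarith

theorem pieceWindow_union_succ (k : ℕ) : pieceWindow k ∪ pieceWindow (k + 1) =
    Set.Icc 0 5 ∩ Set.Icc ((k : ℝ) / 2 - 1 / 4) ((k : ℝ) / 2 + 3 / 4) := by
  ext s
  simp only [pieceWindow, Set.mem_union, Set.mem_ofPred_eq, Set.mem_inter_iff, Set.mem_Icc, abs_le]
  push_cast
  constructor
  · rintro (⟨h, h1, h2⟩ | ⟨h, h1, h2⟩) <;> exact ⟨h, by linarith, by linarith⟩
  · rintro ⟨h, h1, h2⟩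
    rcases le_total s ((k : ℝ) / 2 + 1 / 4) with h3 | h3
    · exact .inl ⟨h, by linarith, by linarith⟩
    · exact .inr ⟨h, by linarith, by linarith⟩

theorem exists_pieceWindow_union {k l : Fin 11} (hkl : (k : ℕ) ≤ l) (hlk : (l : ℕ) ≤ k + 1) :
    ∃ m : Fin 10, pieceWindow k ∪ pieceWindow l ⊆ pieceWindow m ∪ pieceWindow (m + 1) := by
  rcases eq_or_ne (k : ℕ) 10 with hk | hk
  · refine ⟨9, ?_⟩
    rw [hk, show (l : ℕ) = 10 by lia, Set.union_self]
    exact Set.subset_union_right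
  · refine ⟨⟨k, by lia⟩, Set.union_subset Set.subset_union_left ?_⟩
    obtain hl | hl : (l : ℕ) = k ∨ (l : ℕ) = k + 1 := by lia
    · rw [hl]
      exact Set.subset_union_left
    · rw [hl]
      exact Set.subset_union_right

/-- The curve `a` on `[0, 5]` stays within the bounds `P k` during `pieceWindow k`. -/
structure Tracks (a : ℝ → R3) (P : Fin 11 → Piece) : Prop where
  pos : ∀ k : Fin 11, ∀ s ∈ pieceWindow k, InHull (P k).hull (a s)
  vel : ∀ k : Fin 11, ∀ s ∈ pieceWindow k, InCone (P k).vel (deriv a s)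

/-- The functionals in `F` show that the blends of two curves which stay within the bounds `P₀` and
`P₁` are embedded. -/
structure CertifiesArc (F : List IntVec) (P₀ P₁ : Fin 11 → Piece) : Prop where
  distant : ∀ k l : Fin 11, (k : ℕ) + 1 < l →
    Separated F (P₀ k).hull (P₁ k).hull (P₀ l).hull (P₁ l).hull
  adjacent : ∀ k : Fin 10, HasCommonDirection F
    ((P₀ k.castSucc).vel ++ (P₁ k.castSucc).vel ++ (P₀ k.succ).vel ++ (P₁ k.succ).vel)

theorem hasDerivAt_blend {a₀ a₁ : ℝ → R3} (h₀ : ContDiff ℝ ∞ a₀) (h₁ : ContDiff ℝ ∞ a₁) (t s : ℝ) :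
    HasDerivAt (blend t a₀ a₁) ((1 - t) • deriv a₀ s + t • deriv a₁ s) s :=
  ((h₀.differentiable (by simp) s).hasDerivAt.const_smul (1 - t)).add
    ((h₁.differentiable (by simp) s).hasDerivAt.const_smul t)

namespace CertifiesArc

variable {a₀ a₁ : ℝ → R3} {F : List IntVec} {P₀ P₁ : Fin 11 → Piece} {t : ℝ}

theorem exists_pairing_deriv_pos (hc : CertifiesArc F P₀ P₁) (h₀ : ContDiff ℝ ∞ a₀)
    (h₁ : ContDiff ℝ ∞ a₁) (ht₀ : Tracks a₀ P₀) (ht₁ : Tracks a₁ P₁) (ht : t ∈ Set.Icc (0 : ℝ) 1)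
    (k : Fin 10) : ∃ c : IntVec, ∀ s ∈ pieceWindow k ∪ pieceWindow (k + 1),
      0 < pairing c (deriv (blend t a₀ a₁) s) := by
  obtain ⟨c, -, hv⟩ := hc.adjacent k
  simp only [List.mem_append] at hv
  refine ⟨c, fun s hs => ?_⟩
  simp only [(hasDerivAt_blend h₀ h₁ t s).deriv, map_add, map_smul, smul_eq_mul]
  rcases hs with hs | hs
  · exact convexCombo_pos ht (ht₀.vel k.castSucc s hs c fun q hq => hv q (by simp [hq]))
      (ht₁.vel k.castSucc s hs c fun q hq => hv q (by simp [hq]))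
  · rw [← Fin.val_succ] at hs
    exact convexCombo_pos ht (ht₀.vel k.succ s hs c fun q hq => hv q (by simp [hq]))
      (ht₁.vel k.succ s hs c fun q hq => hv q (by simp [hq]))

theorem injOn_pieceWindow_union (hc : CertifiesArc F P₀ P₁) (h₀ : ContDiff ℝ ∞ a₀)
    (h₁ : ContDiff ℝ ∞ a₁) (ht₀ : Tracks a₀ P₀) (ht₁ : Tracks a₁ P₁) (ht : t ∈ Set.Icc (0 : ℝ) 1)
    (k : Fin 10) : Set.InjOn (blend t a₀ a₁) (pieceWindow k ∪ pieceWindow (k + 1)) := by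
  obtain ⟨c, hpos⟩ := hc.exists_pairing_deriv_pos h₀ h₁ ht₀ ht₁ ht k
  have h_diff : Differentiable ℝ (blend t a₀ a₁) :=
    fun s => (hasDerivAt_blend h₀ h₁ t s).differentiableAt
  have h_convex : Convex ℝ (pieceWindow k ∪ pieceWindow (k + 1)) := by
    rw [pieceWindow_union_succ]
    exact (convex_Icc 0 5).inter (convex_Icc _ _)
  have h_mono : StrictMonoOn (fun s => pairing c (blend t a₀ a₁ s))
      (pieceWindow k ∪ pieceWindow (k + 1)) := by
    refine strictMonoOn_of_deriv_pos h_convex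
      ((pairing c).continuous.comp h_diff.continuous).continuousOn fun s hs => ?_
    have h_deriv := (pairing c).hasFDerivAt.comp_hasDerivAt s (h_diff s).hasDerivAt
    exact (hpos s (interior_subset hs)).trans_eq h_deriv.deriv.symm
  exact fun s hs s' hs' he => h_mono.injOn hs hs' (congrArg (pairing c) he)

theorem injOn (hc : CertifiesArc F P₀ P₁) (h₀ : ContDiff ℝ ∞ a₀) (h₁ : ContDiff ℝ ∞ a₁)
    (ht₀ : Tracks a₀ P₀) (ht₁ : Tracks a₁ P₁) (ht : t ∈ Set.Icc (0 : ℝ) 1) :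
    Set.InjOn (blend t a₀ a₁) (Set.Icc 0 5) := by
  have eq_of_le : ∀ k l : Fin 11, k ≤ l → ∀ s ∈ pieceWindow k, ∀ s' ∈ pieceWindow l,
      blend t a₀ a₁ s = blend t a₀ a₁ s' → s = s' := fun k l hkl s hs s' hs' he => by
    rcases lt_or_ge ((k : ℕ) + 1) l with h_distant | h_adjacent
    · exact absurd he ((hc.distant k l h_distant).convexCombo_ne (ht₀.pos k s hs) (ht₁.pos k s hs)
        (ht₀.pos l s' hs') (ht₁.pos l s' hs') ht)
    · obtain ⟨m, hm⟩ := exists_pieceWindow_union hkl h_adjacent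
      exact hc.injOn_pieceWindow_union h₀ h₁ ht₀ ht₁ ht m (hm (.inl hs)) (hm (.inr hs')) he
  intro s hs s' hs' he
  obtain ⟨k, hk⟩ := exists_mem_pieceWindow hs
  obtain ⟨l, hl⟩ := exists_mem_pieceWindow hs'
  rcases le_total k l with hkl | hlk
  · exact eq_of_le k l hkl s hk s' hl he
  · exact (eq_of_le l k hlk s' hl s hk he.symm).symm

theorem deriv_ne_zero (hc : CertifiesArc F P₀ P₁) (h₀ : ContDiff ℝ ∞ a₀) (h₁ : ContDiff ℝ ∞ a₁)
    (ht₀ : Tracks a₀ P₀) (ht₁ : Tracks a₁ P₁) (ht : t ∈ Set.Icc (0 : ℝ) 1) {s : ℝ}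
    (hs : s ∈ Set.Icc (0 : ℝ) 5) : deriv (blend t a₀ a₁) s ≠ 0 := by
  obtain ⟨k, hk⟩ := exists_mem_pieceWindow hs
  obtain ⟨m, hm⟩ := exists_pieceWindow_union (le_refl k) (Nat.le_succ k)
  obtain ⟨c, hpos⟩ := hc.exists_pairing_deriv_pos h₀ h₁ ht₀ ht₁ ht m
  exact fun h_zero => (hpos s (hm (.inl hk))).ne' (by rw [h_zero, map_zero])

end CertifiesArc

/-- The functionals in `F` show that the blends of two closed curves through the cylinders at the
heights `h₀` and `h₁`, whose arcs stay within the bounds `P₀` and `P₁`, are embedded. The first and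
the last piece of an arc meet a cylinder, so they are not compared with the boxes. -/
structure Certifies (F : List IntVec) (h₀ h₁ : ℤ) (P₀ P₁ : Fin 4 → Fin 11 → Piece) : Prop where
  arc : ∀ i, CertifiesArc F (P₀ i) (P₁ i)
  distinct_arcs : ∀ i j : Fin 4, i < j → ∀ k l : Fin 11,
    Separated F (P₀ i k).hull (P₁ i k).hull (P₀ j l).hull (P₁ j l).hull
  boxes : ∀ i : Fin 4, ∀ k : Fin 11, k ≠ 0 → k ≠ 10 → ∀ side : Fin 2,
    Separated F (P₀ i k).hull (P₁ i k).hull (cylinderHull h₀ side) (cylinderHull h₁ side)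

namespace Certifies

variable {J : StringLink} {γ₀ γ₁ : ℝ → R3} {h₀ h₁ : ℤ} {a₀ a₁ : Fin 4 → ℝ → R3} {F : List IntVec}
  {P₀ P₁ : Fin 4 → Fin 11 → Piece} {t : ℝ}

theorem blend_ne_blend (hc : Certifies F h₀ h₁ P₀ P₁) (ht₀ : ∀ i, Tracks (a₀ i) (P₀ i))
    (ht₁ : ∀ i, Tracks (a₁ i) (P₁ i)) (ht : t ∈ Set.Icc (0 : ℝ) 1) {i j : Fin 4} (hij : i < j)
    {s s' : ℝ} (hs : s ∈ Set.Icc (0 : ℝ) 5) (hs' : s' ∈ Set.Icc (0 : ℝ) 5) :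
    blend t (a₀ i) (a₁ i) s ≠ blend t (a₀ j) (a₁ j) s' := by
  obtain ⟨k, hk⟩ := exists_mem_pieceWindow hs
  obtain ⟨l, hl⟩ := exists_mem_pieceWindow hs'
  exact (hc.distinct_arcs i j hij k l).convexCombo_ne ((ht₀ i).pos k s hk) ((ht₁ i).pos k s hk)
    ((ht₀ j).pos l s' hl) ((ht₁ j).pos l s' hl) ht

theorem blend_notMem_cylinderBox (hc : Certifies F h₀ h₁ P₀ P₁) (hd₀ : Decomposes J γ₀ h₀ a₀)
    (hd₁ : Decomposes J γ₁ h₁ a₁) (ht₀ : ∀ i, Tracks (a₀ i) (P₀ i))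
    (ht₁ : ∀ i, Tracks (a₁ i) (P₁ i)) (ht : t ∈ Set.Icc (0 : ℝ) 1) (i : Fin 4) (side : Fin 2)
    {s : ℝ} (hs : s ∈ Set.Ioo (0 : ℝ) 5) :
    blend t (a₀ i) (a₁ i) s ∉ cylinderBox ((1 - t) * h₀ + t * h₁) side := by
  have hd := hd₀.blend hd₁ t
  rcases le_or_gt s (1 / 4) with h_start | h_start
  · rw [hd.arc_start i ⟨hs.1.le, h_start⟩]
    exact linkPiece_notMem_cylinderBox J _ i (.inr (by linarith [hs.1])) side
  rcases le_or_gt (19 / 4) s with h_finish | h_finish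
  · rw [hd.arc_finish i ⟨h_finish, hs.2.le⟩]
    exact linkPiece_notMem_cylinderBox J _ _ (.inl (by linarith [hs.2])) side
  obtain ⟨k, hk⟩ := exists_mem_pieceWindow (Set.Ioo_subset_Icc_self hs)
  have hk_abs := abs_le.1 hk.2
  have hk_zero : k ≠ 0 := by
    rintro rfl
    norm_num at hk_abs
    linarith
  have hk_ten : k ≠ 10 := by
    rintro rfl
    norm_num at hk_abs
    linarith
  intro hb
  obtain ⟨q₀, hq₀, q₁, hq₁, he⟩ := exists_blend_of_mem_cylinderBox hb
  exact (hc.boxes i k hk_zero hk_ten side).convexCombo_ne ((ht₀ i).pos k s hk)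
    ((ht₁ i).pos k s hk) (inHull_cylinderHull h₀ hq₀) (inHull_cylinderHull h₁ hq₁) ht he.symm

theorem isKnot_blend (hc : Certifies F h₀ h₁ P₀ P₁) (hd₀ : Decomposes J γ₀ h₀ a₀)
    (hd₁ : Decomposes J γ₁ h₁ a₁) (ht₀ : ∀ i, Tracks (a₀ i) (P₀ i))
    (ht₁ : ∀ i, Tracks (a₁ i) (P₁ i)) (ht : t ∈ Set.Icc (0 : ℝ) 1) :
    IsKnot (blend t γ₀ γ₁) := by
  refine (hd₀.blend hd₁ t).isKnot ?immersed ?injective fun i side s =>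
    hc.blend_notMem_cylinderBox hd₀ hd₁ ht₀ ht₁ ht i side
  case immersed =>
    exact fun i s hs => (hc.arc i).deriv_ne_zero (hd₀.smooth_arc i) (hd₁.smooth_arc i) (ht₀ i)
      (ht₁ i) ht (Set.Ioo_subset_Icc_self hs)
  case injective =>
    intro i j s hs s' hs' he
    have hs := Set.Ioo_subset_Icc_self hs
    have hs' := Set.Ioo_subset_Icc_self hs'
    rcases lt_trichotomy i j with hij | rfl | hij
    · exact absurd he (hc.blend_ne_blend ht₀ ht₁ ht hij hs hs')
    · exact ⟨rfl, (hc.arc i).injOn (hd₀.smooth_arc i) (hd₁.smooth_arc i) (ht₀ i) (ht₁ i) ht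
        hs hs' he⟩
    · exact absurd he.symm (hc.blend_ne_blend ht₀ ht₁ ht hij hs' hs)

theorem isotopic (hc : Certifies F h₀ h₁ P₀ P₁) (hd₀ : Decomposes J γ₀ h₀ a₀)
    (hd₁ : Decomposes J γ₁ h₁ a₁) (ht₀ : ∀ i, Tracks (a₀ i) (P₀ i))
    (ht₁ : ∀ i, Tracks (a₁ i) (P₁ i)) : Isotopic γ₀ γ₁ := by
  refine ⟨fun t => blend t γ₀ γ₁, ContDiff.contDiffOn ?smooth,
    fun t ht => hc.isKnot_blend hd₀ hd₁ ht₀ ht₁ ht, blend_zero γ₀ γ₁, blend_one γ₀ γ₁⟩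
  exact ((contDiff_const.sub contDiff_fst).smul (hd₀.contDiff.comp contDiff_snd)).add
    (contDiff_fst.smul (hd₁.contDiff.comp contDiff_snd))

end Certifies

/-! ### Rounded polygons -/

/-- The path through the points `v 0, …, v (n + 1)` with rounded corners. -/
def polyPath (v : ℕ → R3) : ℕ → ℝ → R3
  | 0, s => v 0 + s • (v 1 - v 0)
  | n + 1, s => polyPath v n s
      + ramp (s - (n + 1 : ℕ)) • ((v (n + 2) - v (n + 1)) - (v (n + 1) - v n))

/-- The velocity of `polyPath`. -/
def polyVel (v : ℕ → R3) : ℕ → ℝ → R3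
  | 0, _ => v 1 - v 0
  | n + 1, s => polyVel v n s + Real.smoothTransition (2 * (s - (n + 1 : ℕ)) + 1 / 2) •
      ((v (n + 2) - v (n + 1)) - (v (n + 1) - v n))

theorem roundedPath_eq_polyPath {v : Fin 6 → R3} {u : ℕ → R3} (h : ∀ k : Fin 6, v k = u k) :
    roundedPath v = polyPath u 4 := by
  funext s
  have h0 := h 0
  have h1 := h 1
  have h2 := h 2
  simp only [Fin.isValue, Fin.val_zero, Fin.val_one, Fin.val_two] at h0 h1 h2
  simp only [roundedPath, polyPath, h0, h1, h2, h 3, h 4, h 5]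
  norm_num

theorem contDiff_polyPath (v : ℕ → R3) (n : ℕ) : ContDiff ℝ ∞ (polyPath v n) := by
  induction n with
  | zero => exact contDiff_const.add (contDiff_id.smul contDiff_const)
  | succ n ih =>
    exact ih.add ((contDiff_ramp.comp (contDiff_id.sub contDiff_const)).smul contDiff_const)

theorem hasDerivAt_polyPath (v : ℕ → R3) (n : ℕ) (s : ℝ) :
    HasDerivAt (polyPath v n) (polyVel v n s) s := by
  induction n with
  | zero =>
    simpa [polyPath, polyVel] using ((hasDerivAt_id s).smul_const (v 1 - v 0)).const_add (v 0)
  | succ n ih =>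
    have hr := (hasDerivAt_ramp (s - (n + 1 : ℕ))).comp s ((hasDerivAt_id s).sub_const _)
    rw [mul_one] at hr
    exact ih.add (hr.smul_const _)

theorem polyPath_of_ge (v : ℕ → R3) (n : ℕ) {s : ℝ} (hs : (n : ℝ) + 1 / 4 ≤ s) :
    polyPath v n s = v n + (s - n) • (v (n + 1) - v n) := by
  induction n with
  | zero => simp [polyPath]
  | succ n ih =>
    push_cast at hs
    rw [polyPath, ih (by linarith), ramp_of_ge (by push_cast; linarith)]
    push_cast
    module

theorem polyVel_of_ge (v : ℕ → R3) (n : ℕ) {s : ℝ} (hs : (n : ℝ) + 1 / 4 ≤ s) :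
    polyVel v n s = v (n + 1) - v n := by
  induction n with
  | zero => rfl
  | succ n ih =>
    push_cast at hs
    rw [polyVel, ih (by linarith), Real.smoothTransition.one_of_one_le (by push_cast; linarith),
      one_smul, add_sub_cancel]

theorem polyPath_of_le (v : ℕ → R3) {n m : ℕ} (hnm : n ≤ m) {s : ℝ} (hs : s ≤ n + 3 / 4) :
    polyPath v m s = polyPath v n s := by
  induction m, hnm using Nat.le_induction with
  | base => rfl
  | succ m hm ih =>
    have : (n : ℝ) ≤ m := by exact_mod_cast hm
    rw [polyPath, ih, ramp_of_le (by push_cast; linarith), zero_smul, add_zero]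

theorem polyVel_of_le (v : ℕ → R3) {n m : ℕ} (hnm : n ≤ m) {s : ℝ} (hs : s ≤ n + 3 / 4) :
    polyVel v m s = polyVel v n s := by
  induction m, hnm using Nat.le_induction with
  | base => rfl
  | succ m hm ih =>
    have : (n : ℝ) ≤ m := by exact_mod_cast hm
    rw [polyVel, ih, Real.smoothTransition.zero_of_nonpos (by push_cast; linarith), zero_smul,
      add_zero]

theorem polyPath_start (v : ℕ → R3) (m : ℕ) {s : ℝ} (hs : s ≤ 3 / 4) :
    polyPath v m s = v 0 + s • (v 1 - v 0) :=
  polyPath_of_le v (Nat.zero_le m) (by simpa using hs)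

theorem polyVel_start (v : ℕ → R3) (m : ℕ) {s : ℝ} (hs : s ≤ 3 / 4) :
    polyVel v m s = v 1 - v 0 :=
  polyVel_of_le v (Nat.zero_le m) (by simpa using hs)

theorem polyPath_straight (v : ℕ → R3) {k m : ℕ} (hk : k ≤ m) {s : ℝ} (h0 : (k : ℝ) + 1 / 4 ≤ s)
    (h1 : s ≤ k + 3 / 4) : polyPath v m s = v k + (s - k) • (v (k + 1) - v k) := by
  rw [polyPath_of_le v hk h1, polyPath_of_ge v k h0]

theorem polyVel_straight (v : ℕ → R3) {k m : ℕ} (hk : k ≤ m) {s : ℝ} (h0 : (k : ℝ) + 1 / 4 ≤ s)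
    (h1 : s ≤ k + 3 / 4) : polyVel v m s = v (k + 1) - v k := by
  rw [polyVel_of_le v hk h1, polyVel_of_ge v k h0]

theorem polyPath_corner (v : ℕ → R3) {k m : ℕ} (hk : k < m) {s : ℝ}
    (hs : |s - (k + 1 : ℕ)| ≤ 3 / 4) :
    polyPath v m s = v (k + 1) - ramp (-(s - (k + 1 : ℕ))) • (v (k + 1) - v k)
      + ramp (s - (k + 1 : ℕ)) • (v (k + 2) - v (k + 1)) := by
  obtain ⟨h0, h1⟩ := abs_le.1 hs
  push_cast at h0 h1
  rw [polyPath_of_le v (Nat.succ_le_of_lt hk) (by push_cast; linarith), polyPath,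
    polyPath_of_ge v k (by linarith), ramp_neg]
  push_cast
  module

theorem polyVel_corner (v : ℕ → R3) {k m : ℕ} (hk : k < m) {s : ℝ}
    (hs : |s - (k + 1 : ℕ)| ≤ 3 / 4) :
    polyVel v m s = (1 - Real.smoothTransition (2 * (s - (k + 1 : ℕ)) + 1 / 2)) • (v (k + 1) - v k)
      + Real.smoothTransition (2 * (s - (k + 1 : ℕ)) + 1 / 2) • (v (k + 2) - v (k + 1)) := by
  obtain ⟨h0, h1⟩ := abs_le.1 hs
  push_cast at h0 h1
  rw [polyVel_of_le v (Nat.succ_le_of_lt hk) (by push_cast; linarith), polyVel,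
    polyVel_of_ge v k (by linarith)]
  module

theorem exists_polyPath_eq (v : ℕ → R3) {k m : ℕ} (hk : k ≤ m + 1) {r s : ℝ}
    (hr : r ∈ Set.Icc (1 / 4 : ℝ) (3 / 4)) (hs : s ∈ Set.Icc (0 : ℝ) (m + 1)) (hks : |s - k| ≤ r) :
    ∃ α β : ℝ, 0 ≤ α ∧ 0 ≤ β ∧ α + β ≤ r ∧ (α = 0 ∨ k ≠ 0) ∧ (β = 0 ∨ k ≠ m + 1) ∧
      polyPath v m s = v k - α • (v k - v (k - 1)) + β • (v (k + 1) - v k) := by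
  obtain ⟨h0, h1⟩ := abs_le.1 hks
  obtain ⟨hr0, hr1⟩ := hr
  rcases Nat.eq_zero_or_pos k with rfl | hk_pos
  · rw [Nat.cast_zero] at h1
    refine ⟨0, s, le_rfl, hs.1, by linarith, .inl rfl, .inr (by simp), ?_⟩
    rw [polyPath_start v m (by linarith), zero_smul, sub_zero]
  rcases hk.eq_or_lt with rfl | hk_lt
  · push_cast at h0
    refine ⟨m + 1 - s, 0, by linarith [hs.2], le_rfl, by linarith, .inr (by simp), .inl rfl, ?_⟩
    rw [polyPath_of_ge v m (by linarith), Nat.add_sub_cancel]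
    module
  · obtain ⟨j, rfl⟩ := Nat.exists_eq_add_of_le' hk_pos
    refine ⟨_, _, ramp_nonneg _, ramp_nonneg _, ?_, .inr (by simp), .inr hk_lt.ne,
      polyPath_corner v (by lia) (hks.trans hr1)⟩
    rw [add_comm]
    exact ramp_add_ramp_neg_le hks hr0

theorem exists_polyVel_eq (v : ℕ → R3) {k m : ℕ} (hk : k ≤ m + 1) {s : ℝ} (hks : |s - k| ≤ 3 / 4) :
    ∃ x y : ℝ, 0 ≤ x ∧ 0 ≤ y ∧ x + y = 1 ∧ (x = 0 ∨ k ≠ 0) ∧ (y = 0 ∨ k ≠ m + 1) ∧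
      polyVel v m s = x • (v k - v (k - 1)) + y • (v (k + 1) - v k) := by
  obtain ⟨h0, h1⟩ := abs_le.1 hks
  rcases Nat.eq_zero_or_pos k with rfl | hk_pos
  · rw [Nat.cast_zero] at h1
    refine ⟨0, 1, le_rfl, zero_le_one, zero_add 1, .inl rfl, .inr (by simp), ?_⟩
    rw [polyVel_start v m (by linarith), zero_smul, zero_add, one_smul]
  rcases hk.eq_or_lt with rfl | hk_lt
  · push_cast at h0
    refine ⟨1, 0, zero_le_one, le_rfl, add_zero 1, .inr (by simp), .inl rfl, ?_⟩
    rw [polyVel_of_ge v m (by linarith), Nat.add_sub_cancel, zero_smul, add_zero, one_smul]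
  · obtain ⟨j, rfl⟩ := Nat.exists_eq_add_of_le' hk_pos
    exact ⟨_, _, sub_nonneg.2 (Real.smoothTransition.le_one _), Real.smoothTransition.nonneg _,
      sub_add_cancel _ _, .inr (by simp), .inr hk_lt.ne, polyVel_corner v (by lia) hks⟩

/-- The point with coordinates `p` in units of `1/n`. -/
def gridPoint (n : ℝ) (p : IntVec) : R3 := !₂[p.1 / n, p.2.1 / n, p.2.2 / n]

theorem gridPoint_sub (n : ℝ) (p q : IntVec) :
    gridPoint n (p - q) = gridPoint n p - gridPoint n q := by
  ext i
  fin_cases i <;> simp [gridPoint, sub_div]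

theorem gridPoint_add (n : ℝ) (p q : IntVec) :
    gridPoint n (p + q) = gridPoint n p + gridPoint n q := by
  ext i
  fin_cases i <;> simp [gridPoint, add_div]

theorem gridPoint_six (p : IntVec) : gridPoint 6 p = (2 : ℝ) • gridPoint 12 p := by
  ext i
  fin_cases i <;> simp [gridPoint] <;> ring

theorem pairing_gridPoint (c : IntVec) (n : ℝ) (p : IntVec) :
    pairing c (gridPoint n p) = intDot c p / n := by
  rw [pairing_apply]
  simp only [gridPoint, intDot, Int.cast_add, Int.cast_mul, PiLp.toLp_apply, Matrix.cons_val]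
  ring

theorem intDot_add (c p q : IntVec) : intDot c (p + q) = intDot c p + intDot c q := by
  simp only [intDot, Prod.fst_add, Prod.snd_add]
  ring

theorem inHull_of_forall_le {H : List IntVec} {p : R3} (hH : H ≠ [])
    (h : ∀ (c : IntVec) (m : ℤ), (∀ q ∈ H, m ≤ intDot c q) → (m : ℝ) ≤ 24 * pairing c p) :
    InHull H p := fun c => by
  obtain ⟨q, hq, h_min⟩ :=
    H.toFinset.exists_min_image (intDot c) (List.toFinset_nonempty_iff H |>.2 hH)
  simp only [List.mem_toFinset] at hq h_min
  exact ⟨q, hq, h c _ h_min⟩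

theorem inHull_corner {H : List IntVec} {p q r : IntVec} {α β : ℝ} (hα : 0 ≤ α) (hβ : 0 ≤ β)
    (hαβ : α + β ≤ 1 / 2) (hp : α = 0 ∨ p + q ∈ H) (hq : q + q ∈ H) (hr : β = 0 ∨ q + r ∈ H) :
    InHull H (gridPoint 12 q - α • (gridPoint 12 q - gridPoint 12 p)
      + β • (gridPoint 12 r - gridPoint 12 q)) := by
  refine inHull_of_forall_le (List.ne_nil_of_mem hq) fun c m hm => ?_
  have le_of_mem : ∀ {x y : IntVec}, x + y ∈ H → (m : ℝ) ≤ intDot c x + intDot c y := fun h => by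
    exact_mod_cast intDot_add c _ _ ▸ hm _ h
  have h_p : α * m ≤ α * (intDot c p + intDot c q) := by
    rcases hp with rfl | hp
    · simp
    · exact mul_le_mul_of_nonneg_left (le_of_mem hp) hα
  have h_r : β * m ≤ β * (intDot c q + intDot c r) := by
    rcases hr with rfl | hr
    · simp
    · exact mul_le_mul_of_nonneg_left (le_of_mem hr) hβ
  have h_q : (1 - 2 * α - 2 * β) * m ≤ (1 - 2 * α - 2 * β) * (intDot c q + intDot c q) :=
    mul_le_mul_of_nonneg_left (le_of_mem hq) (by linarith)
  simp only [map_add, map_sub, map_smul, pairing_gridPoint, smul_eq_mul]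
  linarith

theorem inCone_corner {V : List IntVec} {v w : IntVec} {n x y : ℝ} (hn : 0 < n) (hx : 0 ≤ x)
    (hy : 0 ≤ y) (hxy : 0 < x + y) (hv : x = 0 ∨ v ∈ V) (hw : y = 0 ∨ w ∈ V) :
    InCone V (x • gridPoint n v + y • gridPoint n w) := by
  intro c hc
  have term_nonneg : ∀ {μ : ℝ} {u : IntVec}, 0 ≤ μ → (μ = 0 ∨ u ∈ V) →
      0 ≤ μ * (intDot c u / n) ∧ (0 < μ → 0 < μ * (intDot c u / n)) := fun hμ h => by
    rcases h with rfl | hu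
    · simp
    · have hu : (0 : ℝ) < intDot c _ / n := div_pos (Int.cast_pos.2 (hc _ hu)) hn
      exact ⟨mul_nonneg hμ hu.le, fun h => mul_pos h hu⟩
  obtain ⟨hv_nonneg, hv_pos⟩ := term_nonneg hx hv
  obtain ⟨hw_nonneg, hw_pos⟩ := term_nonneg hy hw
  simp only [map_add, map_smul, pairing_gridPoint, smul_eq_mul]
  rcases hx.eq_or_lt with rfl | hx
  · exact add_pos_of_nonneg_of_pos hv_nonneg (hw_pos (by linarith))
  · exact add_pos_of_pos_of_nonneg (hv_pos hx) hw_nonneg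

/-- The bounds for a rounded polygon with vertices `w 0, …, w 10`, in units of `1/12`, that passes
the `k`-th vertex during `pieceWindow k`. -/
def polygonPieces (w : ℕ → IntVec) (k : Fin 11) : Piece where
  hull := (if k = 0 then [] else [w (k - 1) + w k]) ++ [w k + w k] ++
    if k = 10 then [] else [w k + w (k + 1)]
  vel := (if k = 0 then [] else [w k - w (k - 1)]) ++ if k = 10 then [] else [w (k + 1) - w k]

theorem tracks_polygonPieces {a : ℝ → R3} {w : ℕ → IntVec}
    (h_pos : ∀ k : Fin 11, ∀ s ∈ pieceWindow k, ∃ α β : ℝ, 0 ≤ α ∧ 0 ≤ β ∧ α + β ≤ 1 / 2 ∧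
      (α = 0 ∨ k ≠ 0) ∧ (β = 0 ∨ k ≠ 10) ∧
      a s = gridPoint 12 (w k) - α • (gridPoint 12 (w k) - gridPoint 12 (w (k - 1)))
        + β • (gridPoint 12 (w (k + 1)) - gridPoint 12 (w k)))
    (h_vel : ∀ k : Fin 11, ∀ s ∈ pieceWindow k, ∃ x y : ℝ, 0 ≤ x ∧ 0 ≤ y ∧ 0 < x + y ∧
      (x = 0 ∨ k ≠ 0) ∧ (y = 0 ∨ k ≠ 10) ∧
      deriv a s = x • (gridPoint 12 (w k) - gridPoint 12 (w (k - 1)))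
        + y • (gridPoint 12 (w (k + 1)) - gridPoint 12 (w k))) :
    Tracks a (polygonPieces w) where
  pos k s hs := by
    obtain ⟨α, β, hα, hβ, hαβ, hα0, hβ0, he⟩ := h_pos k s hs
    rw [he]
    exact inHull_corner hα hβ hαβ (hα0.imp_right fun h => by simp [polygonPieces, h])
      (by simp [polygonPieces]) (hβ0.imp_right fun h => by simp [polygonPieces, h])
  vel k s hs := by
    obtain ⟨x, y, hx, hy, hxy, hx0, hy0, he⟩ := h_vel k s hs
    rw [he, ← gridPoint_sub, ← gridPoint_sub]
    exact inCone_corner (by norm_num) hx hy hxy (hx0.imp_right fun h => by simp [polygonPieces, h])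
      (hy0.imp_right fun h => by simp [polygonPieces, h])

/-- The rounded polygon with vertices `w 0, …, w 10`, in units of `1/12`, run through for
`s ∈ [0, 5]`. -/
def polygonArc (w : ℕ → IntVec) (s : ℝ) : R3 := polyPath (fun k => gridPoint 12 (w k)) 9 (2 * s)

theorem contDiff_polygonArc (w : ℕ → IntVec) : ContDiff ℝ ∞ (polygonArc w) :=
  (contDiff_polyPath _ 9).comp (contDiff_const.mul contDiff_id)

theorem hasDerivAt_polygonArc (w : ℕ → IntVec) (s : ℝ) : HasDerivAt (polygonArc w)
    ((2 : ℝ) • polyVel (fun k => gridPoint 12 (w k)) 9 (2 * s)) s :=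
  (hasDerivAt_polyPath _ 9 _).scomp s (by simpa using (hasDerivAt_id s).const_mul (2 : ℝ))

theorem tracks_polygonArc (w : ℕ → IntVec) : Tracks (polygonArc w) (polygonPieces w) := by
  refine tracks_polygonPieces (fun k s hs => ?pos) fun k s hs => ?vel
  case pos =>
    obtain ⟨α, β, hα, hβ, hαβ, hα0, hβ0, he⟩ := exists_polyPath_eq
      (fun k => gridPoint 12 (w k)) (m := 9) (by lia : (k : ℕ) ≤ 10) (r := 1 / 2) (by norm_num)
      ⟨by linarith [hs.1.1], by norm_num; linarith [hs.1.2]⟩ hs.2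
    exact ⟨α, β, hα, hβ, hαβ, hα0.imp_right (by lia), hβ0.imp_right (by lia), he⟩
  case vel =>
    obtain ⟨x, y, hx, hy, hxy, hx0, hy0, he⟩ := exists_polyVel_eq
      (fun k => gridPoint 12 (w k)) (m := 9) (by lia : (k : ℕ) ≤ 10)
      (hs.2.trans (by norm_num : (1 / 2 : ℝ) ≤ 3 / 4))
    refine ⟨2 * x, 2 * y, by linarith, by linarith, by linarith, hx0.imp (by simp +contextual)
      (by lia), hy0.imp (by simp +contextual) (by lia), ?_⟩
    rw [(hasDerivAt_polygonArc w s).deriv, he, smul_add, smul_smul, smul_smul]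

/-- The polygon with vertices `v`, in units of `1/6`, with the midpoints of its edges as additional
vertices, in units of `1/12`. -/
def subdivide (v : ℕ → IntVec) (k : ℕ) : IntVec := v (k / 2) + v ((k + 1) / 2)

theorem subdivide_even (v : ℕ → IntVec) (j : ℕ) : subdivide v (2 * j) = v j + v j := by
  rw [subdivide, show 2 * j / 2 = j by lia, show (2 * j + 1) / 2 = j by lia]

theorem subdivide_odd (v : ℕ → IntVec) (j : ℕ) : subdivide v (2 * j + 1) = v j + v (j + 1) := by
  rw [subdivide, show (2 * j + 1) / 2 = j by lia, show (2 * j + 1 + 1) / 2 = j + 1 by lia]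

theorem subdivide_even_pred (v : ℕ → IntVec) (j : ℕ) :
    subdivide v (2 * j - 1) = v (j - 1) + v j := by
  rcases j with _ | j
  · rfl
  · exact subdivide_odd v j

theorem abs_sub_le_of_mem_pieceWindow_even {j : ℕ} {s : ℝ} (hs : s ∈ pieceWindow (2 * j)) :
    |s - j| ≤ 1 / 4 := by
  obtain ⟨h0, h1⟩ := abs_le.1 hs.2
  push_cast at h0 h1
  exact abs_le.2 ⟨by linarith, by linarith⟩

theorem mem_Icc_of_mem_pieceWindow_odd {j : ℕ} {s : ℝ} (hs : s ∈ pieceWindow (2 * j + 1)) :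
    s ∈ Set.Icc (j + 1 / 4 : ℝ) (j + 3 / 4) := by
  obtain ⟨h0, h1⟩ := abs_le.1 hs.2
  push_cast at h0 h1
  exact ⟨by linarith, by linarith⟩

theorem exists_polyPath_eq_subdivide (v : ℕ → IntVec) {k : ℕ} (hk : k ≤ 10) {s : ℝ}
    (hs : s ∈ pieceWindow k) : ∃ α β : ℝ, 0 ≤ α ∧ 0 ≤ β ∧ α + β ≤ 1 / 2 ∧ (α = 0 ∨ k ≠ 0) ∧
      (β = 0 ∨ k ≠ 10) ∧ polyPath (fun k => gridPoint 6 (v k)) 4 s =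
        gridPoint 12 (subdivide v k)
          - α • (gridPoint 12 (subdivide v k) - gridPoint 12 (subdivide v (k - 1)))
          + β • (gridPoint 12 (subdivide v (k + 1)) - gridPoint 12 (subdivide v k)) := by
  obtain ⟨j, rfl | rfl⟩ := Nat.even_or_odd' k
  · obtain ⟨α, β, hα, hβ, hαβ, hα0, hβ0, he⟩ := exists_polyPath_eq
      (fun k => gridPoint 6 (v k)) (m := 4) (by lia : j ≤ 5) (r := 1 / 4) (by norm_num)
      ⟨hs.1.1, by norm_num; exact hs.1.2⟩ (abs_sub_le_of_mem_pieceWindow_even hs)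
    refine ⟨2 * α, 2 * β, by linarith, by linarith, by linarith, hα0.imp (by simp +contextual)
      (by lia), hβ0.imp (by simp +contextual) (by lia), ?_⟩
    rw [he]
    simp only [subdivide_even, subdivide_odd, subdivide_even_pred, gridPoint_add, gridPoint_six]
    module
  · obtain ⟨h0, h1⟩ := mem_Icc_of_mem_pieceWindow_odd hs
    simp only [polyPath_straight _ (by lia : j ≤ 4) h0 h1, Nat.add_sub_cancel, subdivide_even,
      subdivide_odd, gridPoint_add, gridPoint_six, show 2 * j + 1 + 1 = 2 * (j + 1) by ring]
    rcases le_total (2 * s) (2 * j + 1) with h | h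
    · refine ⟨2 * j + 1 - 2 * s, 0, by linarith, le_rfl, by linarith, .inr (by lia), .inl rfl, ?_⟩
      module
    · refine ⟨0, 2 * s - (2 * j + 1), le_rfl, by linarith, by linarith, .inl rfl, .inr (by lia), ?_⟩
      module

theorem exists_polyVel_eq_subdivide (v : ℕ → IntVec) {k : ℕ} (hk : k ≤ 10) {s : ℝ}
    (hs : s ∈ pieceWindow k) : ∃ x y : ℝ, 0 ≤ x ∧ 0 ≤ y ∧ 0 < x + y ∧ (x = 0 ∨ k ≠ 0) ∧
      (y = 0 ∨ k ≠ 10) ∧ polyVel (fun k => gridPoint 6 (v k)) 4 s =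
        x • (gridPoint 12 (subdivide v k) - gridPoint 12 (subdivide v (k - 1)))
          + y • (gridPoint 12 (subdivide v (k + 1)) - gridPoint 12 (subdivide v k)) := by
  obtain ⟨j, rfl | rfl⟩ := Nat.even_or_odd' k
  · obtain ⟨x, y, hx, hy, hxy, hx0, hy0, he⟩ := exists_polyVel_eq
      (fun k => gridPoint 6 (v k)) (m := 4) (by lia : j ≤ 5)
      ((abs_sub_le_of_mem_pieceWindow_even hs).trans (by norm_num : (1 / 4 : ℝ) ≤ 3 / 4))
    refine ⟨2 * x, 2 * y, by linarith, by linarith, by linarith, hx0.imp (by simp +contextual)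
      (by lia), hy0.imp (by simp +contextual) (by lia), ?_⟩
    rw [he]
    simp only [subdivide_even, subdivide_odd, subdivide_even_pred, gridPoint_add, gridPoint_six]
    module
  · obtain ⟨h0, h1⟩ := mem_Icc_of_mem_pieceWindow_odd hs
    refine ⟨1, 1, zero_le_one, zero_le_one, by norm_num, .inr (by lia), .inr (by lia), ?_⟩
    simp only [polyVel_straight _ (by lia : j ≤ 4) h0 h1, Nat.add_sub_cancel, subdivide_even,
      subdivide_odd, gridPoint_add, gridPoint_six, show 2 * j + 1 + 1 = 2 * (j + 1) by ring]
    module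

theorem tracks_polyPath_subdivide (v : ℕ → IntVec) :
    Tracks (polyPath (fun k => gridPoint 6 (v k)) 4) (polygonPieces (subdivide v)) := by
  refine tracks_polygonPieces (fun k s hs => ?pos) fun k s hs => ?vel
  case pos =>
    obtain ⟨α, β, hα, hβ, hαβ, hα0, hβ0, he⟩ := exists_polyPath_eq_subdivide v (by lia) hs
    exact ⟨α, β, hα, hβ, hαβ, hα0.imp_right (by lia), hβ0.imp_right (by lia), he⟩
  case vel =>
    obtain ⟨x, y, hx, hy, hxy, hx0, hy0, he⟩ := exists_polyVel_eq_subdivide v (by lia) hs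
    exact ⟨x, y, hx, hy, hxy, hx0.imp_right (by lia), hy0.imp_right (by lia),
      ((hasDerivAt_polyPath _ 4 s).deriv).trans he⟩

/-! ### The figure -/

/-- The list of points, continued by zeros. -/
def vertices (l : List IntVec) (k : ℕ) : IntVec := l.getD k 0

/-- The vertices of the four arcs of the figure, in units of `1/6`. -/
def figureVertices : Fin 4 → ℕ → IntVec :=
  ![vertices [(-27, 6, 6), (-27, 12, 6), (-18, 24, 6), (12, -6, 6), (21, -6, -6), (21, 0, -6)],
    vertices [(21, 6, -6), (21, 12, -6), (-6, -6, -6), (6, -6, 6), (-21, 12, 6), (-21, 6, 6)],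
    vertices [(-21, 0, 6), (-21, -6, 6), (-12, -6, -6), (18, 24, -6), (27, 12, -6), (27, 6, -6)],
    vertices [(27, 0, -6), (27, -6, -6), (21, -12, -6), (-21, -12, 6), (-27, -6, 6), (-27, 0, 6)]]

/-- The arcs of the figure between the strands. -/
def figureArc (i : Fin 4) : ℝ → R3 := polyPath (fun k => gridPoint 6 (figureVertices i k)) 4

/-- The bounds for the arcs of the figure. -/
def figurePieces (i : Fin 4) : Fin 11 → Piece := polygonPieces (subdivide (figureVertices i))

theorem tracks_figureArc (i : Fin 4) : Tracks (figureArc i) (figurePieces i) :=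
  tracks_polyPath_subdivide _

theorem contDiff_figureArc (i : Fin 4) : ContDiff ℝ ∞ (figureArc i) := contDiff_polyPath _ _

theorem figureArc_eq_roundedPath :
    figureArc = ![roundedPath arcA, roundedPath arcB, roundedPath arcC, roundedPath arcD] := by
  have eq_of_forall : ∀ (v : Fin 6 → R3) (i : Fin 4),
      (∀ k : Fin 6, v k = gridPoint 6 (figureVertices i k)) → figureArc i = roundedPath v :=
    fun v i h => (roundedPath_eq_polyPath h).symm
  funext i
  fin_cases i <;> refine eq_of_forall _ _ fun k => ?_ <;> fin_cases k <;>
    norm_num [arcA, arcB, arcC, arcD, gridPoint, figureVertices, vertices]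

theorem passageTime_eq_vecCons (i : Fin 4) (τ : ℝ) :
    passageTime i τ = ![τ, τ, 1 - τ, 1 - τ] i := by
  fin_cases i <;> rfl

theorem linkPiece_vertical (J : StringLink) (h : ℝ) (i : Fin 4) {τ : ℝ} (hτ : τ ≤ 0 ∨ 1 ≤ τ) :
    linkPiece J h i τ = ![!₂[-(9 / 2), τ, h], !₂[7 / 2, τ, -h], !₂[-(7 / 2), 1 - τ, h],
      !₂[9 / 2, 1 - τ, -h]] i := by
  have h_vertical := fun j => J.vertical j τ hτ
  have h_vertical_rev := fun j => J.vertical j (1 - τ)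
    (hτ.symm.imp (fun _ => by linarith) fun _ => by linarith)
  rw [linkPiece, passageTime_eq_vecCons]
  ext m
  fin_cases i <;> fin_cases m <;>
    simp [cylinderBase, cylinderSymm, passageSide, passageStrand, flipMap, mirrorMap,
      h_vertical, h_vertical_rev, basePoint] <;>
    norm_num

theorem fits_figureArc (J : StringLink) : Fits J 1 figureArc where
  start i s h0 h1 := by
    rw [figureArc, polyPath_start _ _ (by linarith), linkPiece_vertical J 1 i (.inr (by linarith))]
    ext m
    fin_cases i <;> fin_cases m <;> simp [gridPoint, figureVertices, vertices] <;> ring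
  finish i s h0 h1 := by
    rw [figureArc, polyPath_of_ge _ _ (by norm_num; linarith),
      linkPiece_vertical J 1 (i + 1) (.inl (by linarith))]
    ext m
    fin_cases i <;> fin_cases m <;> simp [gridPoint, figureVertices, vertices] <;> ring

theorem figureKnot_block (J : StringLink) (i : Fin 4) {v : ℝ} (hv : v ∈ Set.Ico (0 : ℝ) 6) :
    figureKnot J ((6 * (i : ℕ) + v) / 24) = blockCurve J 1 figureArc i v := by
  obtain ⟨h0, h6⟩ := hv
  have hi : ((i : ℕ) : ℝ) ≤ 3 := by exact_mod_cast Nat.le_of_lt_succ i.2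
  have h_fract : Int.fract ((6 * (i : ℕ) + v) / 24) = (6 * (i : ℕ) + v) / 24 :=
    Int.fract_eq_self.2 ⟨by positivity, by linarith⟩
  rw [figureKnot, h_fract, mul_div_cancel₀ _ (by norm_num), blockCurve, figureArc_eq_roundedPath]
  clear hi h_fract
  have h_left : ∀ j τ, leftStrand J j τ = cylinderBase 1 0 + cylinderSymm 0 (J.strand j τ) :=
    fun _ _ => rfl
  have h_right : ∀ j τ, rightStrand J j τ = cylinderBase 1 1 + cylinderSymm 1 (J.strand j τ) :=
    fun _ _ => rfl
  have h_shift : 6 + v - 7 = v - 1 ∧ 12 + v - 13 = v - 1 ∧ 18 + v - 19 = v - 1 ∧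
      13 - (12 + v) = 1 - v ∧ 19 - (18 + v) = 1 - v := by
    refine ⟨?_, ?_, ?_, ?_, ?_⟩ <;> ring
  simp only [figureLoop, h_left, h_right, linkPiece, passageTime_eq_vecCons]
  fin_cases i <;> norm_num [h_shift] <;> split_ifs <;> first | linarith | rfl

theorem decomposes_figureKnot (J : StringLink) :
    Decomposes J (figureKnot J) (1 : ℤ) figureArc := by
  rw [Int.cast_one]
  exact .of_blocks (fun s => by rw [figureKnot, figureKnot, Int.fract_add_one])
    (fun i v hv => figureKnot_block J i hv) (fits_figureArc J) contDiff_figureArc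

/-! ### The twist about the axis -/

/-- The rotation by the angle `θ` about the axis `y = 1/2`, `z = 0`, which is the common centre line
of the cylinders in standard position. -/
def axisRotate (θ : ℝ) (p : R3) : R3 :=
  !₂[p 0, 1 / 2 + ((p 1 - 1 / 2) * Real.cos θ - p 2 * Real.sin θ),
    (p 1 - 1 / 2) * Real.sin θ + p 2 * Real.cos θ]

theorem axisRotate_apply_zero (θ : ℝ) (p : R3) : axisRotate θ p 0 = p 0 := rfl

theorem axisRotate_axisRotate (θ φ : ℝ) (p : R3) :
    axisRotate θ (axisRotate φ p) = axisRotate (θ + φ) p := by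
  ext m
  fin_cases m <;> simp [axisRotate, Real.cos_add, Real.sin_add] <;> ring

theorem axisRotate_zero (p : R3) : axisRotate 0 p = p := by
  ext m
  fin_cases m <;> simp [axisRotate]

theorem axisRotate_pi (p : R3) : axisRotate Real.pi p = !₂[p 0, 1 - p 1, -p 2] := by
  ext m
  fin_cases m <;> simp [axisRotate]
  ring

theorem contDiff_axisRotate {E : Type*} [NormedAddCommGroup E] [NormedSpace ℝ E] {θ : E → ℝ}
    {p : E → R3} (hθ : ContDiff ℝ ∞ θ) (hp : ContDiff ℝ ∞ p) :
    ContDiff ℝ ∞ fun e => axisRotate (θ e) (p e) := by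
  have hc := Real.contDiff_cos.comp hθ
  have hs := Real.contDiff_sin.comp hθ
  have h1 := ((contDiff_coord 1).comp hp).sub (contDiff_const (c := (1 / 2 : ℝ)))
  have h2 := (contDiff_coord 2).comp hp
  exact contDiff_vec3 ((contDiff_coord 0).comp hp)
    (contDiff_const.add ((h1.mul hc).sub (h2.mul hs))) ((h1.mul hs).add (h2.mul hc))

/-- The angle of the twist over `x`, which increases from `0` at `x = -5/4` to `π` at `x = 5/4`. -/
def twistAngle (x : ℝ) : ℝ := Real.pi * ((ramp (x + 1) - ramp (x - 1)) / 2)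

theorem twistAngle_of_le {x : ℝ} (hx : x ≤ -(5 / 4)) : twistAngle x = 0 := by
  rw [twistAngle, ramp_of_le (by linarith), ramp_of_le (by linarith), sub_zero, zero_div, mul_zero]

theorem twistAngle_neg (x : ℝ) : twistAngle (-x) = Real.pi - twistAngle x := by
  rw [twistAngle, twistAngle, show -x + 1 = -(x - 1) by ring, show -x - 1 = -(x + 1) by ring,
    ramp_neg, ramp_neg]
  ring

theorem twistAngle_of_ge {x : ℝ} (hx : 5 / 4 ≤ x) : twistAngle x = Real.pi := by
  rw [← neg_neg x, twistAngle_neg, twistAngle_of_le (by linarith), sub_zero]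

theorem contDiff_twistAngle : ContDiff ℝ ∞ twistAngle :=
  contDiff_const.mul (((contDiff_ramp.comp (contDiff_id.add contDiff_const)).sub
    (contDiff_ramp.comp (contDiff_id.sub contDiff_const))).div_const 2)

theorem exists_hasDerivAt_twistAngle (x : ℝ) : ∃ δ, |δ| ≤ 2 ∧ HasDerivAt twistAngle δ x := by
  have h_add := (hasDerivAt_ramp (x + 1)).comp x ((hasDerivAt_id x).add_const 1)
  have h_sub := (hasDerivAt_ramp (x - 1)).comp x ((hasDerivAt_id x).sub_const 1)
  refine ⟨_, ?_, ((h_add.sub h_sub).div_const 2).const_mul Real.pi⟩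
  have h_speed : ∀ {u v : ℝ}, |(Real.smoothTransition u * 1 - Real.smoothTransition v * 1) / 2|
      ≤ 1 / 2 := fun {u v} => by
    have hu := Real.smoothTransition.nonneg u
    have hu' := Real.smoothTransition.le_one u
    have hv := Real.smoothTransition.nonneg v
    have hv' := Real.smoothTransition.le_one v
    exact abs_le.2 ⟨by linarith, by linarith⟩
  rw [abs_mul, abs_of_pos Real.pi_pos]
  calc Real.pi * _ ≤ 4 * (1 / 2) :=
        mul_le_mul Real.pi_le_four h_speed (abs_nonneg _) (by norm_num)
    _ = 2 := by norm_num

theorem twistAngle_left {x : ℝ} (hx : x ≤ -(1 / 3)) :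
    twistAngle x ∈ Set.Icc 0 (Real.pi / 3) := by
  have h_mono := monotone_ramp (show x + 1 ≤ 2 / 3 by linarith)
  rw [ramp_of_ge (s := 2 / 3) (by norm_num)] at h_mono
  rw [twistAngle, ramp_of_le (s := x - 1) (by linarith), sub_zero]
  exact ⟨mul_nonneg Real.pi_pos.le (div_nonneg (ramp_nonneg _) zero_le_two),
    by nlinarith [Real.pi_pos]⟩

theorem twistAngle_middle {x : ℝ} (hx : |x| ≤ 1 / 3) :
    twistAngle x ∈ Set.Icc (Real.pi / 3) (Real.pi - Real.pi / 3) := by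
  obtain ⟨h0, h1⟩ := abs_le.1 hx
  rw [twistAngle, ramp_of_ge (by linarith), ramp_of_le (by linarith), sub_zero]
  constructor <;> nlinarith [Real.pi_pos]

/-- The twist about the axis: the planes `x = const` are turned by `twistAngle x`. -/
def axisTwist (p : R3) : R3 := axisRotate (twistAngle (p 0)) p

theorem axisTwist_of_le {p : R3} (hp : p 0 ≤ -(5 / 4)) : axisTwist p = p := by
  rw [axisTwist, twistAngle_of_le hp, axisRotate_zero]

theorem axisTwist_of_ge {p : R3} (hp : 5 / 4 ≤ p 0) : axisTwist p = axisRotate Real.pi p := by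
  rw [axisTwist, twistAngle_of_ge hp]

theorem contDiff_axisTwist : ContDiff ℝ ∞ axisTwist :=
  contDiff_axisRotate (contDiff_twistAngle.comp (contDiff_coord 0)) contDiff_id

theorem hasDerivAt_vec3 {a b c : ℝ → ℝ} {a' b' c' s : ℝ} (ha : HasDerivAt a a' s)
    (hb : HasDerivAt b b' s) (hc : HasDerivAt c c' s) :
    HasDerivAt (fun s => (!₂[a s, b s, c s] : R3)) !₂[a', b', c'] s := by
  refine (PiLp.continuousLinearEquiv 2 ℝ fun _ : Fin 3 => ℝ).symm.toContinuousLinearMap.hasFDerivAt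
    |>.comp_hasDerivAt s (hasDerivAt_pi.2 fun i => ?_)
  fin_cases i
  exacts [ha, hb, hc]

theorem hasDerivAt_coord {a : ℝ → R3} {v : R3} {s : ℝ} (h : HasDerivAt a v s) (m : Fin 3) :
    HasDerivAt (fun s => a s m) (v m) s :=
  (EuclideanSpace.proj m : R3 →L[ℝ] ℝ).hasFDerivAt.comp_hasDerivAt s h

theorem exists_hasDerivAt_axisTwist {a : ℝ → R3} {d s : ℝ} (ha : HasDerivAt a !₂[d, 0, 0] s) :
    ∃ δ, |δ| ≤ 2 * |d| ∧ HasDerivAt (fun s => axisTwist (a s))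
      !₂[d, -(δ * axisTwist (a s) 2), δ * (axisTwist (a s) 1 - 1 / 2)] s := by
  obtain ⟨δ, hδ, h_angle⟩ := exists_hasDerivAt_twistAngle (a s 0)
  have h0 : HasDerivAt (fun s => a s 0) d s := hasDerivAt_coord ha 0
  have h1 : HasDerivAt (fun s => a s 1 - 1 / 2) 0 s := (hasDerivAt_coord ha 1).sub_const _
  have h2 : HasDerivAt (fun s => a s 2) 0 s := hasDerivAt_coord ha 2
  have h_comp := h_angle.comp s h0
  refine ⟨δ * d, by rw [abs_mul]; exact mul_le_mul_of_nonneg_right hδ (abs_nonneg d), ?_⟩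
  refine (hasDerivAt_vec3 h0 (((h1.mul h_comp.cos).sub (h2.mul h_comp.sin)).const_add (1 / 2))
    ((h1.mul h_comp.sin).add (h2.mul h_comp.cos))).congr_deriv ?_
  ext m
  fin_cases m <;> simp [axisTwist, axisRotate] <;> ring

/-! ### The standard position -/

/-- The vertices of the outer arc before it is twisted, in units of `1/12`. -/
def outerVertices : List IntVec :=
  [(-54, 12, 0), (-54, 18, 0), (-54, 36, 0), (-24, 36, 0), (-8, 36, 0), (0, 36, 0), (8, 36, 0),
    (24, 36, 0), (42, 36, 0), (42, 18, 0), (42, 12, 0)]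

/-- The vertices of the middle arc, in units of `1/12`. -/
def middleVertices : List IntVec :=
  [(42, 12, 0), (42, 18, 0), (30, 18, 0), (24, 6, 0), (12, 6, 0), (0, 6, 0), (-12, 6, 0),
    (-24, 6, 0), (-30, 18, 0), (-42, 18, 0), (-42, 12, 0)]

/-- The vertices of the lower arc, in units of `1/12`. -/
def lowerVertices : List IntVec :=
  [(54, 0, 0), (54, -6, 0), (72, 6, 0), (96, 6, 0), (96, -96, 0), (0, -120, 0), (-96, -96, 0),
    (-96, 6, 0), (-72, 6, 0), (-54, -6, 0), (-54, 0, 0)]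

theorem polyPath_apply_two {v : ℕ → R3} (hv : ∀ k, v k 2 = 0) (n : ℕ) (s : ℝ) :
    polyPath v n s 2 = 0 := by
  induction n with
  | zero => simp [polyPath, hv]
  | succ n ih => simp [polyPath, hv, ih]

theorem polygonArc_vertices_apply_two {l : List IntVec} (hl : ∀ p ∈ l, p.2.2 = 0) (s : ℝ) :
    polygonArc (vertices l) s 2 = 0 := by
  refine polyPath_apply_two (fun k => ?_) _ _
  have h_vertex : (vertices l k).2.2 = 0 := by
    rw [vertices, List.getD_eq_getElem?_getD]
    rcases h : l[k]? with _ | p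
    · rfl
    · exact hl p (List.mem_of_getElem? h)
  simp [gridPoint, h_vertex]

theorem map_polyPath {f : R3 → R3}
    (hf : ∀ p q r (t : ℝ), f (p + t • (q - r)) = f p + t • (f q - f r))
    (v : ℕ → R3) (n : ℕ) (s : ℝ) : f (polyPath v n s) = polyPath (fun k => f (v k)) n s := by
  induction n with
  | zero => exact hf _ _ _ _
  | succ n ih =>
    have split : ∀ (p a b c : R3) (t : ℝ),
        p + t • ((a - b) - (b - c)) = p + t • (a - b) + t • (c - b) := fun p a b c t => by module
    rw [polyPath, polyPath, split, split, hf, hf, ih]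

/-- The half turn about the axis, in units of `1/12`. -/
def halfTurnVec (p : IntVec) : IntVec := (p.1, 12 - p.2.1, -p.2.2)

theorem axisRotate_pi_polygonArc (w : ℕ → IntVec) (s : ℝ) :
    axisRotate Real.pi (polygonArc w s) = polygonArc (fun k => halfTurnVec (w k)) s := by
  have h_grid (p : IntVec) :
      axisRotate Real.pi (gridPoint 12 p) = gridPoint 12 (halfTurnVec p) := by
    rw [axisRotate_pi]
    ext m
    fin_cases m <;> simp [gridPoint, halfTurnVec] <;> ring
  rw [polygonArc, map_polyPath (f := axisRotate Real.pi) fun p q r t => ?affine]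
  case affine =>
    simp only [axisRotate_pi]
    ext m
    fin_cases m <;> simp <;> ring
  simp only [h_grid, polygonArc]

/-- The outer arc before it is twisted. -/
def outerPath : ℝ → R3 := polygonArc (vertices outerVertices)

/-- The outer arc, which makes half a turn about the axis. -/
def twistedArc (s : ℝ) : R3 := axisTwist (outerPath s)

theorem outerPath_apply_two (s : ℝ) : outerPath s 2 = 0 :=
  polygonArc_vertices_apply_two (by decide) s

theorem contDiff_twistedArc : ContDiff ℝ ∞ twistedArc :=
  contDiff_axisTwist.comp (contDiff_polygonArc _)

/-- The edges of a cone that contains the velocity of the twisted part of the outer arc. -/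
def twistVel : List IntVec := [(1, 10, 10), (1, 10, -10), (1, -10, 10), (1, -10, -10)]

/-- The bounds for the outer arc. -/
def twistedPieces (k : Fin 11) : Piece :=
  if k < 4 then polygonPieces (vertices outerVertices) k
  else if k = 4 then ⟨boxHull (-32, 42, 0) (-8, 72, 60), twistVel⟩
  else if k = 5 then ⟨boxHull (-8, -18, 48) (8, 42, 60), twistVel⟩
  else if k = 6 then ⟨boxHull (8, -48, 0) (32, -18, 60), twistVel⟩
  else polygonPieces (fun k => halfTurnVec (vertices outerVertices k)) k

theorem InHull.coord_mem_Icc {H : List IntVec} {p : R3} (h : InHull H p) {l u : IntVec}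
    (hl : ∀ q ∈ H, l ≤ q) (hu : ∀ q ∈ H, q ≤ u) :
    24 * p 0 ∈ Set.Icc (l.1 : ℝ) u.1 ∧ 24 * p 1 ∈ Set.Icc (l.2.1 : ℝ) u.2.1 ∧
      24 * p 2 ∈ Set.Icc (l.2.2 : ℝ) u.2.2 := by
  have bound : ∀ (c : IntVec) (m : ℤ), (∀ q ∈ H, m ≤ intDot c q) → (m : ℝ) ≤ 24 * pairing c p :=
    fun c m hm => by
      obtain ⟨q, hq, hqp⟩ := h c
      exact (Int.cast_le.2 (hm q hq)).trans hqp
  have hx := bound (1, 0, 0) l.1 fun q hq => by simpa [intDot] using (hl q hq).1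
  have hx' := bound (-1, 0, 0) (-u.1) fun q hq => by simpa [intDot] using (hu q hq).1
  have hy := bound (0, 1, 0) l.2.1 fun q hq => by simpa [intDot] using (hl q hq).2.1
  have hy' := bound (0, -1, 0) (-u.2.1) fun q hq => by simpa [intDot] using (hu q hq).2.1
  have hz := bound (0, 0, 1) l.2.2 fun q hq => by simpa [intDot] using (hl q hq).2.2
  have hz' := bound (0, 0, -1) (-u.2.2) fun q hq => by simpa [intDot] using (hu q hq).2.2
  simp only [pairing_apply] at hx hx' hy hy' hz hz'
  push_cast at hx hx' hy hy' hz hz'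
  exact ⟨⟨by linarith, by linarith⟩, ⟨by linarith, by linarith⟩, by linarith, by linarith⟩

theorem polygonArc_coord_mem_Icc {w : ℕ → IntVec} {k : Fin 11} {s : ℝ} (hs : s ∈ pieceWindow k)
    {l u : IntVec} (h : ∀ q ∈ (polygonPieces w k).hull, l ≤ q ∧ q ≤ u) :
    24 * polygonArc w s 0 ∈ Set.Icc (l.1 : ℝ) u.1 ∧
      24 * polygonArc w s 1 ∈ Set.Icc (l.2.1 : ℝ) u.2.1 ∧
      24 * polygonArc w s 2 ∈ Set.Icc (l.2.2 : ℝ) u.2.2 :=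
  ((tracks_polygonArc w).pos k s hs).coord_mem_Icc (fun q hq => (h q hq).1) fun q hq => (h q hq).2

theorem outerPath_left {k : Fin 11} (hk : k < 4) {s : ℝ} (hs : s ∈ pieceWindow k) :
    outerPath s 0 < -(5 / 4) := by
  have h : ∀ k : Fin 11, k < 4 → ∀ q ∈ (polygonPieces (vertices outerVertices) k).hull,
      (-108, 24, 0) ≤ q ∧ q ≤ (-32, 72, 0) := by
    decide
  have hx := (polygonArc_coord_mem_Icc hs (h k hk)).1.2
  push_cast at hx
  rw [outerPath]
  linarith

theorem outerPath_right {k : Fin 11} (hk : 6 < k) {s : ℝ} (hs : s ∈ pieceWindow k) :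
    5 / 4 < outerPath s 0 := by
  have h : ∀ k : Fin 11, 6 < k → ∀ q ∈ (polygonPieces (vertices outerVertices) k).hull,
      (32, 24, 0) ≤ q ∧ q ≤ (84, 72, 0) := by
    decide
  have hx := (polygonArc_coord_mem_Icc hs (h k hk)).1.1
  push_cast at hx
  rw [outerPath]
  linarith

theorem outerPath_middle {k : Fin 11} (hk : 4 ≤ k ∧ k ≤ 6) {s : ℝ} (hs : s ∈ pieceWindow k) :
    outerPath s 1 = 3 := by
  have h : ∀ k : Fin 11, 4 ≤ k ∧ k ≤ 6 → ∀ q ∈ (polygonPieces (vertices outerVertices) k).hull,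
      (-32, 72, 0) ≤ q ∧ q ≤ (32, 72, 0) := by
    decide
  have hy := (polygonArc_coord_mem_Icc hs (h k hk)).2.1
  push_cast at hy
  rw [outerPath]
  linarith [hy.1, hy.2]

theorem exists_hasDerivAt_outerPath {k : Fin 11} (hk : 4 ≤ k ∧ k ≤ 6) {s : ℝ}
    (hs : s ∈ pieceWindow k) : ∃ d > 0, HasDerivAt outerPath !₂[d, 0, 0] s := by
  obtain ⟨x, y, hx, hy, hxy, -, -, h_vel⟩ := exists_polyVel_eq
    (fun k => gridPoint 12 (vertices outerVertices k)) (m := 9) (by lia : (k : ℕ) ≤ 10)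
    (hs.2.trans (by norm_num : (1 / 2 : ℝ) ≤ 3 / 4))
  obtain ⟨e, he, f, hf, h_edges⟩ : ∃ e ≥ (2 / 3 : ℝ), ∃ f ≥ (2 / 3 : ℝ),
      gridPoint 12 (vertices outerVertices k) - gridPoint 12 (vertices outerVertices (k - 1)) =
        !₂[e, 0, 0] ∧
      gridPoint 12 (vertices outerVertices (k + 1)) - gridPoint 12 (vertices outerVertices k) =
        !₂[f, 0, 0] := by
    obtain rfl | rfl | rfl : k = 4 ∨ k = 5 ∨ k = 6 := by lia
    · refine ⟨4 / 3, by norm_num, 2 / 3, by norm_num, ?_⟩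
      constructor <;> ext m <;> fin_cases m <;> norm_num [gridPoint, vertices, outerVertices]
    · refine ⟨2 / 3, by norm_num, 2 / 3, by norm_num, ?_⟩
      constructor <;> ext m <;> fin_cases m <;> norm_num [gridPoint, vertices, outerVertices]
    · refine ⟨2 / 3, by norm_num, 4 / 3, by norm_num, ?_⟩
      constructor <;> ext m <;> fin_cases m <;> norm_num [gridPoint, vertices, outerVertices]
  refine ⟨2 * (x * e + y * f), by nlinarith, (hasDerivAt_polygonArc _ s).congr_deriv ?_⟩
  rw [h_vel, h_edges.1, h_edges.2]
  ext m
  fin_cases m <;> simp [mul_add]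

theorem axisTwist_of_height {p : R3} (hy : p 1 = 3) (hz : p 2 = 0) : axisTwist p =
    !₂[p 0, 1 / 2 + 5 / 2 * Real.cos (twistAngle (p 0)),
      5 / 2 * Real.sin (twistAngle (p 0))] := by
  rw [axisTwist, axisRotate, hy, hz]
  norm_num

theorem cos_sin_mem_Icc_of_le_pi_div_three {α : ℝ} (hα : α ∈ Set.Icc 0 (Real.pi / 3)) :
    Real.cos α ∈ Set.Icc (1 / 2) 1 ∧ Real.sin α ∈ Set.Icc 0 1 := by
  have h_cos := Real.cos_le_cos_of_nonneg_of_le_pi hα.1 (by linarith [Real.pi_pos]) hα.2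
  rw [Real.cos_pi_div_three] at h_cos
  exact ⟨⟨h_cos, Real.cos_le_one α⟩,
    Real.sin_nonneg_of_nonneg_of_le_pi hα.1 (by linarith [hα.2, Real.pi_pos]), Real.sin_le_one α⟩

theorem inHull_axisTwist_left {p : R3} (hx : 24 * p 0 ∈ Set.Icc (-32 : ℝ) (-8)) (hy : p 1 = 3)
    (hz : p 2 = 0) : InHull (boxHull (-32, 42, 0) (-8, 72, 60)) (axisTwist p) := by
  obtain ⟨h_cos, h_sin⟩ := cos_sin_mem_Icc_of_le_pi_div_three
    (twistAngle_left (x := p 0) (by linarith [hx.2]))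
  rw [axisTwist_of_height hy hz]
  refine inHull_boxHull (by simpa using hx) ?_ ?_ <;> simp only [Matrix.cons_val]
  · push_cast
    exact ⟨by linarith [h_cos.1], by linarith [h_cos.2]⟩
  · push_cast
    exact ⟨by linarith [h_sin.1], by linarith [h_sin.2]⟩

theorem inHull_axisTwist_right {p : R3} (hx : 24 * p 0 ∈ Set.Icc (8 : ℝ) 32) (hy : p 1 = 3)
    (hz : p 2 = 0) : InHull (boxHull (8, -48, 0) (32, -18, 60)) (axisTwist p) := by
  obtain ⟨h_cos, h_sin⟩ := cos_sin_mem_Icc_of_le_pi_div_three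
    (twistAngle_left (x := -p 0) (by linarith [hx.1]))
  rw [twistAngle_neg, Real.cos_pi_sub] at h_cos
  rw [twistAngle_neg, Real.sin_pi_sub] at h_sin
  rw [axisTwist_of_height hy hz]
  refine inHull_boxHull (by simpa using hx) ?_ ?_ <;> simp only [Matrix.cons_val]
  · push_cast
    exact ⟨by linarith [h_cos.2], by linarith [h_cos.1]⟩
  · push_cast
    exact ⟨by linarith [h_sin.1], by linarith [h_sin.2]⟩

theorem inHull_axisTwist_middle {p : R3} (hx : 24 * p 0 ∈ Set.Icc (-8 : ℝ) 8) (hy : p 1 = 3)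
    (hz : p 2 = 0) : InHull (boxHull (-8, -18, 48) (8, 42, 60)) (axisTwist p) := by
  obtain ⟨h_ge, h_le⟩ := twistAngle_middle (x := p 0)
    (abs_le.2 ⟨by linarith [hx.1], by linarith [hx.2]⟩)
  have h_cos_le := Real.cos_le_cos_of_nonneg_of_le_pi (by linarith [Real.pi_pos])
    (by linarith [Real.pi_pos]) h_ge
  have h_le_cos := Real.cos_le_cos_of_nonneg_of_le_pi (by linarith [Real.pi_pos])
    (by linarith [Real.pi_pos]) h_le
  rw [Real.cos_pi_div_three] at h_cos_le
  rw [Real.cos_pi_sub, Real.cos_pi_div_three] at h_le_cos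
  have h_sin_nonneg : 0 ≤ Real.sin (twistAngle (p 0)) :=
    Real.sin_nonneg_of_nonneg_of_le_pi (by linarith [Real.pi_pos]) (by linarith [Real.pi_pos])
  have h_le_sin : 4 / 5 ≤ Real.sin (twistAngle (p 0)) := by
    nlinarith [Real.sin_sq_add_cos_sq (twistAngle (p 0))]
  rw [axisTwist_of_height hy hz]
  refine inHull_boxHull (by simpa using hx) ?_ ?_ <;> simp only [Matrix.cons_val]
  · push_cast
    exact ⟨by linarith, by linarith⟩
  · push_cast
    exact ⟨by linarith, by linarith [Real.sin_le_one (twistAngle (p 0))]⟩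

theorem inCone_twistVel {v : R3} (h0 : 0 < v 0) (h1 : |v 1| ≤ 10 * v 0) (h2 : |v 2| ≤ 10 * v 0) :
    InCone twistVel v := by
  intro c hc
  have h_dir : 10 * |(c.2.1 : ℝ)| + 10 * |(c.2.2 : ℝ)| < c.1 := by
    have h_int : 10 * |c.2.1| + 10 * |c.2.2| < c.1 := by
      simp only [twistVel, List.mem_cons, List.not_mem_nil, or_false, forall_eq_or_imp, forall_eq,
        intDot] at hc
      rcases abs_cases c.2.1 with h | h <;> rcases abs_cases c.2.2 with h' | h' <;> linarith
    exact_mod_cast h_int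
  have term_bound : ∀ {x y : ℝ}, |y| ≤ 10 * v 0 → -(10 * |x| * v 0) ≤ x * y := fun {x y} hy =>
    calc -(10 * |x| * v 0) ≤ -(|x| * |y|) := by nlinarith [abs_nonneg x]
      _ ≤ x * y := by rw [← abs_mul]; exact neg_abs_le _
  rw [pairing_apply]
  linarith [term_bound (x := c.2.1) h1, term_bound (x := c.2.2) h2,
    mul_lt_mul_of_pos_right h_dir h0]

theorem twistedArc_eventuallyEq_left {k : Fin 11} (hk : k < 4) {s : ℝ} (hs : s ∈ pieceWindow k) :
    twistedArc =ᶠ[nhds s] outerPath := by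
  have h_lt : ∀ᶠ r in nhds s, outerPath r 0 < -(5 / 4) :=
    ((contDiff_coord (n := 0) 0).continuous.comp (contDiff_polygonArc _).continuous).continuousAt
      |>.eventually_lt_const (outerPath_left hk hs)
  exact h_lt.mono fun r hr => axisTwist_of_le hr.le

theorem twistedArc_eventuallyEq_right {k : Fin 11} (hk : 6 < k) {s : ℝ} (hs : s ∈ pieceWindow k) :
    twistedArc =ᶠ[nhds s] polygonArc fun k => halfTurnVec (vertices outerVertices k) := by
  have h_gt : ∀ᶠ r in nhds s, 5 / 4 < outerPath r 0 :=
    ((contDiff_coord (n := 0) 0).continuous.comp (contDiff_polygonArc _).continuous).continuousAt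
      |>.eventually_const_lt (outerPath_right hk hs)
  exact h_gt.mono fun r hr => (axisTwist_of_ge hr.le).trans (axisRotate_pi_polygonArc _ r)

theorem inHull_twistedArc_middle {k : Fin 11} (hk : 4 ≤ k ∧ k ≤ 6) {s : ℝ}
    (hs : s ∈ pieceWindow k) : InHull (twistedPieces k).hull (twistedArc s) := by
  have hy := outerPath_middle hk hs
  have hz := outerPath_apply_two s
  obtain rfl | rfl | rfl : k = 4 ∨ k = 5 ∨ k = 6 := by lia
  · have hx := (polygonArc_coord_mem_Icc hs (w := vertices outerVertices) (l := (-32, 72, 0))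
      (u := (-8, 72, 0)) (by decide)).1
    exact inHull_axisTwist_left (by exact_mod_cast hx) hy hz
  · have hx := (polygonArc_coord_mem_Icc hs (w := vertices outerVertices) (l := (-8, 72, 0))
      (u := (8, 72, 0)) (by decide)).1
    exact inHull_axisTwist_middle (by exact_mod_cast hx) hy hz
  · have hx := (polygonArc_coord_mem_Icc hs (w := vertices outerVertices) (l := (8, 72, 0))
      (u := (32, 72, 0)) (by decide)).1
    exact inHull_axisTwist_right (by exact_mod_cast hx) hy hz

theorem inCone_deriv_twistedArc_middle {k : Fin 11} (hk : 4 ≤ k ∧ k ≤ 6) {s : ℝ}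
    (hs : s ∈ pieceWindow k) : InCone twistVel (deriv twistedArc s) := by
  obtain ⟨d, hd, h_outer⟩ := exists_hasDerivAt_outerPath hk hs
  obtain ⟨δ, hδ, h_twisted⟩ := exists_hasDerivAt_axisTwist h_outer
  rw [abs_of_pos hd] at hδ
  have h_bound : ∀ {r : ℝ}, |r| ≤ 1 → |δ * (5 / 2 * r)| ≤ 10 * d := fun {r} hr => by
    rw [abs_mul, abs_mul, abs_of_pos (by norm_num : (0 : ℝ) < 5 / 2)]
    nlinarith [abs_nonneg δ, abs_nonneg r]
  rw [HasDerivAt.deriv (f := twistedArc) h_twisted,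
    axisTwist_of_height (outerPath_middle hk hs) (outerPath_apply_two s)]
  refine inCone_twistVel hd ?_ ?_ <;> simp only [Matrix.cons_val]
  · rw [abs_neg]
    exact h_bound (Real.abs_sin_le_one _)
  · rw [add_sub_cancel_left]
    exact h_bound (Real.abs_cos_le_one _)

theorem tracks_twistedArc : Tracks twistedArc twistedPieces where
  pos k s hs := by
    rcases lt_or_ge k 4 with h4 | h4
    · rw [twistedPieces, if_pos h4, (twistedArc_eventuallyEq_left h4 hs).eq_of_nhds]
      exact (tracks_polygonArc _).pos k s hs
    rcases lt_or_ge 6 k with h6 | h6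
    · rw [twistedPieces, if_neg (by lia), if_neg (by lia), if_neg (by lia), if_neg (by lia),
        (twistedArc_eventuallyEq_right h6 hs).eq_of_nhds]
      exact (tracks_polygonArc _).pos k s hs
    · exact inHull_twistedArc_middle ⟨h4, h6⟩ hs
  vel k s hs := by
    rcases lt_or_ge k 4 with h4 | h4
    · rw [twistedPieces, if_pos h4, (twistedArc_eventuallyEq_left h4 hs).deriv_eq]
      exact (tracks_polygonArc _).vel k s hs
    rcases lt_or_ge 6 k with h6 | h6
    · rw [twistedPieces, if_neg (by lia), if_neg (by lia), if_neg (by lia), if_neg (by lia),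
        (twistedArc_eventuallyEq_right h6 hs).deriv_eq]
      exact (tracks_polygonArc _).vel k s hs
    · have h_vel : (twistedPieces k).vel = twistVel := by
        obtain rfl | rfl | rfl : k = 4 ∨ k = 5 ∨ k = 6 := by lia
        all_goals rfl
      rw [h_vel]
      exact inCone_deriv_twistedArc_middle ⟨h4, h6⟩ hs

/-- The flip in integer coordinates. -/
def flipVec (p : IntVec) : IntVec := (-p.1, p.2.1, -p.2.2)

/-- The bounds for the flip of a curve run through backwards. -/
def flipPiece (P : Piece) : Piece := ⟨P.hull.map flipVec, P.vel.map fun v => -flipVec v⟩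

theorem pairing_flipMap (c : IntVec) (p : R3) : pairing c (flipMap p) = pairing (flipVec c) p := by
  simp [pairing_apply, flipMap, flipVec]

theorem intDot_flipVec (c p : IntVec) : intDot c (flipVec p) = intDot (flipVec c) p := by
  simp [intDot, flipVec]

theorem intDot_neg_right (c p : IntVec) : intDot c (-p) = intDot (-c) p := by
  simp [intDot]

theorem InHull.flip {H : List IntVec} {p : R3} (h : InHull H p) :
    InHull (H.map flipVec) (flipMap p) := fun c => by
  obtain ⟨q, hq, hqp⟩ := h (flipVec c)
  exact ⟨flipVec q, List.mem_map_of_mem hq, by rwa [intDot_flipVec, pairing_flipMap]⟩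

theorem InCone.neg_flip {V : List IntVec} {v : R3} (h : InCone V v) :
    InCone (V.map fun q => -flipVec q) (-flipMap v) := fun c hc => by
  rw [map_neg, pairing_flipMap, ← pairing_neg]
  refine h _ fun q hq => ?_
  have h_pos := hc _ (List.mem_map_of_mem hq)
  rwa [intDot_neg_right, intDot_flipVec] at h_pos

theorem hasDerivAt_flipMap_comp {a : ℝ → R3} {v : R3} {s : ℝ} (h : HasDerivAt a v s) :
    HasDerivAt (fun s => flipMap (a s)) (flipMap v) s :=
  hasDerivAt_vec3 (hasDerivAt_coord h 0).neg (hasDerivAt_coord h 1) (hasDerivAt_coord h 2).neg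

theorem sub_mem_pieceWindow_rev {k : Fin 11} {s : ℝ} (hs : s ∈ pieceWindow k) :
    5 - s ∈ pieceWindow k.rev := by
  have h_rev : ((k.rev : ℕ) : ℝ) = 10 - (k : ℕ) := by
    rw [eq_sub_iff_add_eq]
    have h_sum : (k.rev : ℕ) + (k : ℕ) = 10 := by
      rw [Fin.val_rev]
      lia
    exact_mod_cast h_sum
  refine ⟨⟨by linarith [hs.1.2], by linarith [hs.1.1]⟩, ?_⟩
  rw [h_rev, show 2 * (5 - s) - (10 - ((k : ℕ) : ℝ)) = -(2 * s - (k : ℕ)) by ring, abs_neg]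
  exact hs.2

theorem Tracks.flip_reverse {a : ℝ → R3} {P : Fin 11 → Piece} (h : Tracks a P)
    (ha : ContDiff ℝ ∞ a) :
    Tracks (fun s => flipMap (a (5 - s))) (fun k => flipPiece (P k.rev)) where
  pos k s hs := (h.pos k.rev (5 - s) (sub_mem_pieceWindow_rev hs)).flip
  vel k s hs := by
    have h_rev : HasDerivAt (fun s => a (5 - s)) (-deriv a (5 - s)) s :=
      (ha.differentiable (by simp) (5 - s)).hasDerivAt.comp_const_sub 5 s
    have h_neg : flipMap (-deriv a (5 - s)) = -flipMap (deriv a (5 - s)) := by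
      ext m
      fin_cases m <;> simp [flipMap]
    rw [(hasDerivAt_flipMap_comp h_rev).deriv, h_neg]
    exact (h.vel k.rev (5 - s) (sub_mem_pieceWindow_rev hs)).neg_flip

/-- The arcs of the knot in standard position. -/
def standardArc : Fin 4 → ℝ → R3 :=
  ![twistedArc, polygonArc (vertices middleVertices), fun s => flipMap (twistedArc (5 - s)),
    polygonArc (vertices lowerVertices)]

/-- The bounds for the arcs of the standard position. -/
def standardPieces : Fin 4 → Fin 11 → Piece :=
  ![twistedPieces, polygonPieces (vertices middleVertices),
    fun k => flipPiece (twistedPieces k.rev), polygonPieces (vertices lowerVertices)]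

theorem contDiff_standardArc (i : Fin 4) : ContDiff ℝ ∞ (standardArc i) := by
  fin_cases i
  · exact contDiff_twistedArc
  · exact contDiff_polygonArc _
  · exact contDiff_flipMap.comp (contDiff_twistedArc.comp (contDiff_const.sub contDiff_id))
  · exact contDiff_polygonArc _

theorem tracks_standardArc (i : Fin 4) : Tracks (standardArc i) (standardPieces i) := by
  fin_cases i
  · exact tracks_twistedArc
  · exact tracks_polygonArc _
  · exact tracks_twistedArc.flip_reverse contDiff_twistedArc
  · exact tracks_polygonArc _

theorem twistedArc_start {s : ℝ} (hs : s ≤ 1 / 4) : twistedArc s = !₂[-(9 / 2), 1 + s, 0] := by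
  have h_outer : outerPath s = !₂[-(9 / 2), 1 + s, 0] := by
    rw [outerPath, polygonArc, polyPath_start _ _ (by linarith)]
    ext m
    fin_cases m <;> simp [gridPoint, outerVertices, vertices] <;> ring
  have h_left : outerPath s 0 ≤ -(5 / 4) := by
    rw [h_outer]
    norm_num
  rw [twistedArc, axisTwist_of_le h_left, h_outer]

theorem twistedArc_finish {s : ℝ} (hs : 19 / 4 ≤ s) : twistedArc s = !₂[7 / 2, s - 5, 0] := by
  have h_outer : outerPath s = !₂[7 / 2, 6 - s, 0] := by
    rw [outerPath, polygonArc, polyPath_of_ge _ _ (by norm_num; linarith)]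
    ext m
    fin_cases m <;> simp [gridPoint, outerVertices, vertices] <;> ring
  have h_right : 5 / 4 ≤ outerPath s 0 := by
    rw [h_outer]
    norm_num
  rw [twistedArc, axisTwist_of_ge h_right, axisRotate_pi, h_outer]
  ext m
  fin_cases m <;> simp
  ring

theorem fits_standardArc (J : StringLink) : Fits J 0 standardArc where
  start i s h0 h1 := by
    rw [linkPiece_vertical J 0 i (.inr (by linarith))]
    fin_cases i <;> ext m <;>
      simp only [standardArc, Fin.zero_eta, Fin.mk_one, Fin.reduceFinMk, Matrix.cons_val,
        twistedArc_start h1, twistedArc_finish (s := 5 - s) (by linarith), polygonArc,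
        polyPath_start _ 9 (show 2 * s ≤ 3 / 4 by linarith)] <;>
      fin_cases m <;> simp [flipMap, gridPoint, middleVertices, lowerVertices, vertices] <;> ring
  finish i s h0 h1 := by
    rw [linkPiece_vertical J 0 (i + 1) (.inl (by linarith))]
    fin_cases i <;> ext m <;>
      simp only [standardArc, Fin.zero_eta, Fin.mk_one, Fin.reduceFinMk, Matrix.cons_val,
        twistedArc_finish h0, twistedArc_start (s := 5 - s) (by linarith), polygonArc,
        polyPath_of_ge _ 9 (s := 2 * s) (by norm_num; linarith)] <;>
      fin_cases m <;> simp [flipMap, gridPoint, middleVertices, lowerVertices, vertices] <;> ring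

/-- The knot in standard position. -/
def standardKnot (J : StringLink) : ℝ → R3 := closedCurve J 0 standardArc

theorem decomposes_standardKnot (J : StringLink) :
    Decomposes J (standardKnot J) (0 : ℤ) standardArc := by
  rw [Int.cast_zero]
  exact (fits_standardArc J).decomposes_closedCurve contDiff_standardArc

/-- Functionals that separate the pieces of the figure and of the standard position at the same
time; they were found by a computer search. -/
def functionals : List IntVec :=
  [(4, -1, -2), (-4, -3, 0), (-1, 3, 0), (0, -5, -1), (1, 1, -4), (1, 0, 0), (-3, -1, 4),
    (-4, 1, -1), (3, -4, 0), (3, 4, 0), (-1, -2, -5), (-1, 1, -1), (1, 3, 0), (-1, 1, 0),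
    (-4, -1, 0), (1, -5, 4), (1, 5, 4)]

set_option maxRecDepth 100000 in
theorem certifies_standard : Certifies functionals 1 0 figurePieces standardPieces where
  arc i := ⟨by revert i; decide +kernel, by revert i; decide +kernel⟩
  distinct_arcs := by decide +kernel
  boxes := by decide +kernel

theorem isKnot_blend_standardKnot (J : StringLink) {t : ℝ} (ht : t ∈ Set.Icc (0 : ℝ) 1) :
    IsKnot (blend t (figureKnot J) (standardKnot J)) :=
  certifies_standard.isKnot_blend (decomposes_figureKnot J) (decomposes_standardKnot J)
    tracks_figureArc tracks_standardArc ht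

theorem isKnot_figureKnot (J : StringLink) : IsKnot (figureKnot J) :=
  blend_zero (figureKnot J) (standardKnot J) ▸ isKnot_blend_standardKnot J (by simp)

theorem isKnot_standardKnot (J : StringLink) : IsKnot (standardKnot J) :=
  blend_one (figureKnot J) (standardKnot J) ▸ isKnot_blend_standardKnot J (by simp)

theorem isotopic_standardKnot (J : StringLink) : Isotopic (figureKnot J) (standardKnot J) :=
  certifies_standard.isotopic (decomposes_figureKnot J) (decomposes_standardKnot J)
    tracks_figureArc tracks_standardArc

/-! ### Untwisting the standard position -/

theorem axisRotate_two_pi_sub (θ : ℝ) (p : R3) :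
    axisRotate (2 * Real.pi - θ) p = axisRotate (-θ) p := by
  simp only [axisRotate, Real.cos_two_pi_sub, Real.sin_two_pi_sub, Real.cos_neg, Real.sin_neg]

theorem axisRotate_two_pi (p : R3) : axisRotate (2 * Real.pi) p = p := by
  rw [← sub_zero (2 * Real.pi), axisRotate_two_pi_sub, neg_zero, axisRotate_zero]

theorem mirrorMap_of_apply_two {p : R3} (hz : p 2 = 0) : mirrorMap p = p := by
  ext m
  fin_cases m <;> simp [mirrorMap, hz]

theorem mirrorMap_axisRotate (θ : ℝ) (p : R3) :
    mirrorMap (axisRotate θ p) = axisRotate (-θ) (mirrorMap p) := by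
  ext m
  fin_cases m <;> simp [axisRotate, mirrorMap]
  ring

theorem flipMap_axisRotate (θ : ℝ) (p : R3) :
    flipMap (axisRotate θ p) = axisRotate (-θ) (flipMap p) := by
  ext m
  fin_cases m <;> simp [axisRotate, flipMap]
  ring

/-- The square of the distance from the axis. -/
def axisDistSq (p : R3) : ℝ := (p 1 - 1 / 2) ^ 2 + p 2 ^ 2

theorem axisDistSq_axisRotate (θ : ℝ) (p : R3) : axisDistSq (axisRotate θ p) = axisDistSq p := by
  simp only [axisDistSq, axisRotate, Matrix.cons_val]
  linear_combination ((p 1 - 1 / 2) ^ 2 + p 2 ^ 2) * Real.sin_sq_add_cos_sq θ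

theorem axisDistSq_flipMap (p : R3) : axisDistSq (flipMap p) = axisDistSq p := by
  simp [axisDistSq, flipMap]

theorem axisDistSq_of_apply_two {p : R3} (hz : p 2 = 0) : axisDistSq p = (p 1 - 1 / 2) ^ 2 := by
  simp [axisDistSq, hz]

/-- The angle of the full untwist at `p`. It decreases from `2π` to `0` where the outer arcs are
twisted, and it is cut off left of `x = -13/2` and outside the cylinder of radius `3` about the
axis. -/
def untwistAngle (p : R3) : ℝ :=
  (2 * Real.pi - 2 * twistAngle (p 0)) * Real.smoothTransition (2 * p 0 + 14) *
    Real.smoothTransition ((16 - axisDistSq p) / 7)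

/-- Stage `t` of the isotopy that undoes a full twist about the axis. -/
def untwist (t : ℝ) (p : R3) : R3 := axisRotate (t * untwistAngle p) p

theorem untwistAngle_axisRotate (θ : ℝ) (p : R3) :
    untwistAngle (axisRotate θ p) = untwistAngle p := by
  rw [untwistAngle, axisDistSq_axisRotate, axisRotate_apply_zero, untwistAngle]

theorem untwist_zero : untwist 0 = id := by
  funext p
  rw [untwist, zero_mul, axisRotate_zero, id]

theorem untwist_neg (t : ℝ) (p : R3) : untwist (-t) (untwist t p) = p := by
  rw [untwist, untwist, untwistAngle_axisRotate, axisRotate_axisRotate, neg_mul,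
    neg_add_cancel, axisRotate_zero]

theorem contDiff_untwistAngle : ContDiff ℝ ∞ untwistAngle := by
  have h_dist : ContDiff ℝ ∞ axisDistSq :=
    (((contDiff_coord 1).sub contDiff_const).pow 2).add ((contDiff_coord 2).pow 2)
  have h_twist : ContDiff ℝ ∞ fun p : R3 => twistAngle (p 0) :=
    contDiff_twistAngle.comp (contDiff_coord 0)
  exact ((contDiff_const.sub (contDiff_const.mul h_twist)).mul (Real.smoothTransition.contDiff.comp
    ((contDiff_const.mul (contDiff_coord 0)).add contDiff_const))).mul
    (Real.smoothTransition.contDiff.comp ((contDiff_const.sub h_dist).div_const 7))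

theorem contDiff_untwist : ContDiff ℝ ∞ fun q : ℝ × R3 => untwist q.1 q.2 :=
  contDiff_axisRotate (contDiff_fst.mul (contDiff_untwistAngle.comp contDiff_snd)) contDiff_snd

theorem untwist_of_untwistAngle_eq_zero {p : R3} (h : untwistAngle p = 0) (t : ℝ) :
    untwist t p = p := by
  rw [untwist, h, mul_zero, axisRotate_zero]

theorem untwist_of_right {p : R3} (hx : 5 / 4 ≤ p 0) (t : ℝ) : untwist t p = p :=
  untwist_of_untwistAngle_eq_zero (by rw [untwistAngle, twistAngle_of_ge hx]; ring) t

theorem untwist_of_far_left {p : R3} (hx : p 0 ≤ -7) (t : ℝ) : untwist t p = p := by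
  refine untwist_of_untwistAngle_eq_zero ?_ t
  rw [untwistAngle, Real.smoothTransition.zero_of_nonpos (x := 2 * p 0 + 14) (by linarith),
    mul_zero, zero_mul]

theorem untwist_of_far {p : R3} (hr : 16 ≤ axisDistSq p) (t : ℝ) : untwist t p = p := by
  refine untwist_of_untwistAngle_eq_zero ?_ t
  rw [untwistAngle, Real.smoothTransition.zero_of_nonpos (x := (16 - axisDistSq p) / 7)
    (by linarith), mul_zero]

theorem untwist_of_axis {p : R3} (hy : p 1 = 1 / 2) (hz : p 2 = 0) (t : ℝ) :
    untwist t p = p := by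
  ext m
  fin_cases m <;> simp [untwist, axisRotate, hy, hz]

theorem untwistAngle_of_near {p : R3} (hx : -(13 / 2) ≤ p 0) (hr : axisDistSq p ≤ 9) :
    untwistAngle p = 2 * Real.pi - 2 * twistAngle (p 0) := by
  rw [untwistAngle, Real.smoothTransition.one_of_one_le (by linarith),
    Real.smoothTransition.one_of_one_le (by linarith), mul_one, mul_one]

theorem untwist_one_of_left {p : R3} (hx : -(13 / 2) ≤ p 0) (hx' : p 0 ≤ -(5 / 4))
    (hr : axisDistSq p ≤ 9) : untwist 1 p = p := by
  rw [untwist, untwistAngle_of_near hx hr, twistAngle_of_le hx', mul_zero, sub_zero, one_mul,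
    axisRotate_two_pi]

theorem untwist_axisTwist {p : R3} (hz : p 2 = 0) (hx : -(13 / 2) ≤ p 0) (hr : axisDistSq p ≤ 9) :
    untwist 1 (axisTwist p) = mirrorMap (axisTwist p) := by
  calc untwist 1 (axisTwist p)
      = axisRotate (2 * Real.pi - 2 * twistAngle (p 0)) (axisTwist p) := by
        rw [untwist, one_mul, axisTwist, untwistAngle_axisRotate, untwistAngle_of_near hx hr]
    _ = axisRotate (2 * Real.pi - twistAngle (p 0)) p := by
        rw [axisTwist, axisRotate_axisRotate]
        congr 1
        ring
    _ = mirrorMap (axisTwist p) := by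
        rw [axisRotate_two_pi_sub, axisTwist, mirrorMap_axisRotate, mirrorMap_of_apply_two hz]

theorem flipMap_axisTwist (p : R3) :
    flipMap (axisTwist p) = axisTwist (axisRotate Real.pi (flipMap p)) := by
  have h_angle : twistAngle (flipMap p 0) = Real.pi - twistAngle (p 0) := twistAngle_neg (p 0)
  rw [axisTwist, axisTwist, flipMap_axisRotate, axisRotate_apply_zero, axisRotate_axisRotate,
    h_angle, ← axisRotate_two_pi_sub]
  congr 1
  ring

theorem outerPath_near_axis {s : ℝ} (hs : s ∈ Set.Icc (0 : ℝ) 5) :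
    |outerPath s 0| ≤ 13 / 2 ∧ axisDistSq (outerPath s) ≤ 9 := by
  obtain ⟨k, hk⟩ := exists_mem_pieceWindow hs
  have h : ∀ k : Fin 11, ∀ q ∈ (polygonPieces (vertices outerVertices) k).hull,
      (-108, 24, 0) ≤ q ∧ q ≤ (84, 72, 0) := by
    decide
  obtain ⟨⟨hx, hx'⟩, ⟨hy, hy'⟩, -⟩ := polygonArc_coord_mem_Icc hk (h k)
  push_cast at hx hx' hy hy'
  rw [axisDistSq_of_apply_two (outerPath_apply_two s), outerPath]
  exact ⟨abs_le.2 ⟨by linarith, by linarith⟩, by nlinarith⟩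

theorem untwist_twistedArc {s : ℝ} (hs : s ∈ Set.Icc (0 : ℝ) 5) :
    untwist 1 (twistedArc s) = mirrorMap (twistedArc s) := by
  obtain ⟨hx, hr⟩ := outerPath_near_axis hs
  exact untwist_axisTwist (outerPath_apply_two s) (abs_le.1 hx).1 hr

theorem untwist_flipMap_twistedArc {s : ℝ} (hs : s ∈ Set.Icc (0 : ℝ) 5) :
    untwist 1 (flipMap (twistedArc s)) = mirrorMap (flipMap (twistedArc s)) := by
  obtain ⟨hx, hr⟩ := outerPath_near_axis hs
  rw [twistedArc, flipMap_axisTwist]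
  refine untwist_axisTwist ?_ (neg_le_neg (abs_le.1 hx).2) ?_
  · simp [axisRotate_pi, flipMap, outerPath_apply_two]
  · rwa [axisDistSq_axisRotate, axisDistSq_flipMap]

theorem untwist_linkPiece (J : StringLink) (i : Fin 4) {τ : ℝ} (hτ : τ ∈ Set.Icc (0 : ℝ) 1) :
    untwist 1 (linkPiece J 0 i τ) = linkPiece J 0 i τ := by
  obtain ⟨hx, ⟨hy, hy'⟩, hz⟩ := linkPiece_mem_cylinderBox J 0 i hτ
  rcases Fin.exists_fin_two.1 ⟨passageSide i, rfl⟩ with hk | hk <;>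
    simp only [hk, cylinderBase, Matrix.cons_val, neg_zero, sub_zero, abs_le] at hx hz
  · exact untwist_one_of_left (by linarith) (by linarith) (by unfold axisDistSq; nlinarith)
  · exact untwist_of_right (by linarith) 1

theorem untwist_middleArc {s : ℝ} (hs : s ∈ Set.Icc (0 : ℝ) 5) :
    untwist 1 (polygonArc (vertices middleVertices) s) =
      polygonArc (vertices middleVertices) s := by
  obtain ⟨k, hk⟩ := exists_mem_pieceWindow hs
  have hz := polygonArc_vertices_apply_two (l := middleVertices) (by decide) s
  have right : ∀ k : Fin 11, k < 4 → ∀ q ∈ (polygonPieces (vertices middleVertices) k).hull,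
      (36, 12, 0) ≤ q ∧ q ≤ (84, 36, 0) := by
    decide
  have centre : ∀ k : Fin 11, 4 ≤ k → k < 7 →
      ∀ q ∈ (polygonPieces (vertices middleVertices) k).hull,
      (-36, 12, 0) ≤ q ∧ q ≤ (36, 12, 0) := by
    decide
  have left : ∀ k : Fin 11, 7 ≤ k → ∀ q ∈ (polygonPieces (vertices middleVertices) k).hull,
      (-84, 12, 0) ≤ q ∧ q ≤ (-36, 36, 0) := by
    decide
  rcases lt_or_ge k 4 with h4 | h4
  · obtain ⟨⟨hx, -⟩, -⟩ := polygonArc_coord_mem_Icc hk (right k h4)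
    push_cast at hx
    exact untwist_of_right (by linarith) 1
  rcases lt_or_ge k 7 with h7 | h7
  · obtain ⟨-, ⟨hy, hy'⟩, -⟩ := polygonArc_coord_mem_Icc hk (centre k h4 h7)
    push_cast at hy hy'
    exact untwist_of_axis (by linarith) hz 1
  · obtain ⟨⟨hx, hx'⟩, ⟨hy, hy'⟩, -⟩ := polygonArc_coord_mem_Icc hk (left k h7)
    push_cast at hx hx' hy hy'
    refine untwist_one_of_left (by linarith) (by linarith) ?_
    rw [axisDistSq_of_apply_two hz]
    nlinarith

theorem lowerArc_near_axis {s : ℝ} (hs : s ∈ pieceWindow 8) :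
    polygonArc (vertices lowerVertices) s 1 = 1 / 2 ∨
      polygonArc (vertices lowerVertices) s 0 ∈ Set.Icc (-(13 / 2)) (-(21 / 4)) ∧
        polygonArc (vertices lowerVertices) s 1 ∈ Set.Icc 0 (1 / 2) := by
  have h_corner : polygonArc (vertices lowerVertices) s = !₂[-6 - 2 * ramp (-(2 * s - 8)) +
      3 / 2 * ramp (2 * s - 8), 1 / 2 - ramp (2 * s - 8), 0] := by
    rw [polygonArc, polyPath_corner _ (show 7 < 9 by norm_num) (hs.2.trans (by norm_num))]
    ext m
    fin_cases m <;> norm_num [gridPoint, vertices, lowerVertices] <;> ring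
  have h_le : 2 * s - 8 ≤ 1 / 2 := (abs_le.1 hs.2).2
  rw [h_corner]
  simp only [Matrix.cons_val]
  rcases le_or_gt (2 * s - 8) (-(1 / 4)) with h | h
  · exact .inl (by rw [ramp_of_le h, sub_zero])
  · have hα := ramp_nonneg (-(2 * s - 8))
    have hβ := ramp_nonneg (2 * s - 8)
    have hα' : ramp (-(2 * s - 8)) ≤ 1 / 4 :=
      (monotone_ramp (by linarith)).trans_eq (ramp_of_ge le_rfl)
    have hβ' : ramp (2 * s - 8) ≤ 1 / 2 :=
      (monotone_ramp h_le).trans_eq (ramp_of_ge (by norm_num))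
    exact .inr ⟨⟨by linarith, by linarith⟩, by linarith, by linarith⟩

theorem untwist_lowerArc {s : ℝ} (hs : s ∈ Set.Icc (0 : ℝ) 5) :
    untwist 1 (polygonArc (vertices lowerVertices) s) = polygonArc (vertices lowerVertices) s := by
  obtain ⟨k, hk⟩ := exists_mem_pieceWindow hs
  have hz := polygonArc_vertices_apply_two (l := lowerVertices) (by decide) s
  have right : ∀ k : Fin 11, k < 5 → ∀ q ∈ (polygonPieces (vertices lowerVertices) k).hull,
      (36, -240, 0) ≤ q ∧ q ≤ (192, 12, 0) := by
    decide
  have bottom : ∀ k : Fin 11, 5 ≤ k → k < 7 →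
      ∀ q ∈ (polygonPieces (vertices lowerVertices) k).hull,
      (-192, -240, 0) ≤ q ∧ q ≤ (192, -90, 0) := by
    decide
  have left : ∀ q ∈ (polygonPieces (vertices lowerVertices) 7).hull,
      (-192, -90, 0) ≤ q ∧ q ≤ (-168, 12, 0) := by
    decide
  have last : ∀ k : Fin 11, 8 < k → ∀ q ∈ (polygonPieces (vertices lowerVertices) k).hull,
      (-126, -12, 0) ≤ q ∧ q ≤ (-108, 0, 0) := by
    decide
  have h_cases : k < 5 ∨ 5 ≤ k ∧ k < 7 ∨ k = 7 ∨ k = 8 ∨ 8 < k := by lia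
  rcases h_cases with h | ⟨h, h'⟩ | rfl | rfl | h
  · obtain ⟨⟨hx, -⟩, -⟩ := polygonArc_coord_mem_Icc hk (right k h)
    push_cast at hx
    exact untwist_of_right (by linarith) 1
  · obtain ⟨-, ⟨-, hy⟩, -⟩ := polygonArc_coord_mem_Icc hk (bottom k h h')
    push_cast at hy
    refine untwist_of_far ?_ 1
    rw [axisDistSq_of_apply_two hz]
    nlinarith
  · obtain ⟨⟨-, hx⟩, -⟩ := polygonArc_coord_mem_Icc hk left
    push_cast at hx
    exact untwist_of_far_left (by linarith) 1
  · rcases lowerArc_near_axis hk with hy | ⟨⟨hx, hx'⟩, hy, hy'⟩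
    · exact untwist_of_axis hy hz 1
    · refine untwist_one_of_left hx (by linarith) ?_
      rw [axisDistSq_of_apply_two hz]
      nlinarith
  · obtain ⟨⟨hx, hx'⟩, ⟨hy, hy'⟩, -⟩ := polygonArc_coord_mem_Icc hk (last k h)
    push_cast at hx hx' hy hy'
    refine untwist_one_of_left (by linarith) (by linarith) ?_
    rw [axisDistSq_of_apply_two hz]
    nlinarith

/-! ### The symmetry of the standard position -/

theorem polyPath_eq_sum (v : ℕ → R3) (n : ℕ) (s : ℝ) :
    polyPath v n s = v 0 + s • (v 1 - v 0) + ∑ k ∈ Finset.range n,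
      ramp (s - (k + 1 : ℕ)) • ((v (k + 2) - v (k + 1)) - (v (k + 1) - v k)) := by
  induction n with
  | zero => simp [polyPath]
  | succ n ih => rw [polyPath, ih, Finset.sum_range_succ, add_assoc]

theorem add_sum_smul_secondDifference (v : ℕ → R3) (n : ℕ) (s : ℝ) :
    v 0 + s • (v 1 - v 0) + ∑ k ∈ Finset.range n,
      (s - (k + 1 : ℕ)) • ((v (k + 2) - v (k + 1)) - (v (k + 1) - v k)) =
      v n + (s - n) • (v (n + 1) - v n) := by
  induction n with
  | zero => simp
  | succ n ih =>
    rw [Finset.sum_range_succ, ← add_assoc, ih]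
    push_cast
    module

theorem polyPath_reverse (v : ℕ → R3) (n : ℕ) (s : ℝ) :
    polyPath v n (n + 1 - s) = polyPath (fun k => v (n + 1 - k)) n s := by
  have h_ramp : ∀ k ∈ Finset.range n,
      ramp (n + 1 - s - (k + 1 : ℕ)) • ((v (k + 2) - v (k + 1)) - (v (k + 1) - v k)) =
        ramp (s - (n - k : ℕ)) • ((v (k + 2) - v (k + 1)) - (v (k + 1) - v k)) +
        (n + 1 - s - (k + 1 : ℕ)) • ((v (k + 2) - v (k + 1)) - (v (k + 1) - v k)) :=
    fun k hk => by
      have h_neg : n + 1 - s - (k + 1 : ℕ) = -(s - (n - k : ℕ)) := by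
        rw [Nat.cast_sub (Finset.mem_range.1 hk).le]
        push_cast
        ring
      rw [h_neg, ramp_neg]
      module
  have h_reflect : ∑ k ∈ Finset.range n, ramp (s - (k + 1 : ℕ)) •
        ((v (n + 1 - (k + 2)) - v (n + 1 - (k + 1))) - (v (n + 1 - (k + 1)) - v (n + 1 - k))) =
      ∑ k ∈ Finset.range n,
        ramp (s - (n - k : ℕ)) • ((v (k + 2) - v (k + 1)) - (v (k + 1) - v k)) := by
    rw [← Finset.sum_range_reflect]
    refine Finset.sum_congr rfl fun k hk => ?_
    have hk := Finset.mem_range.1 hk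
    rw [show n - 1 - k + 1 = n - k by lia, show n + 1 - (n - 1 - k + 2) = k by lia,
      show n + 1 - (n - k) = k + 1 by lia, show n + 1 - (n - 1 - k) = k + 2 by lia]
    module
  have h_affine := add_sum_smul_secondDifference v n (n + 1 - s)
  rw [polyPath_eq_sum, polyPath_eq_sum, h_reflect, Finset.sum_congr rfl h_ramp,
    Finset.sum_add_distrib, add_left_comm, h_affine]
  simp only [Nat.sub_zero, Nat.add_sub_cancel]
  module

theorem polyPath_congr {u v : ℕ → R3} {n : ℕ} (h : ∀ k ≤ n + 1, u k = v k) (s : ℝ) :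
    polyPath u n s = polyPath v n s := by
  induction n with
  | zero => simp [polyPath, h 0, h 1]
  | succ n ih =>
    rw [polyPath, polyPath, ih fun k hk => h k (by lia), h n (by lia), h (n + 1) (by lia),
      h (n + 2) (by lia)]

theorem flipMap_gridPoint (n : ℝ) (p : IntVec) :
    flipMap (gridPoint n p) = gridPoint n (flipVec p) := by
  ext m
  fin_cases m <;> simp [flipMap, gridPoint, flipVec] <;> ring

theorem flipMap_polygonArc_reverse {w : ℕ → IntVec} (hw : ∀ k ≤ 10, flipVec (w (10 - k)) = w k)
    (s : ℝ) : flipMap (polygonArc w (5 - s)) = polygonArc w s := by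
  have h_time : 2 * (5 - s) = (9 : ℕ) + 1 - 2 * s := by
    push_cast
    ring
  rw [polygonArc, h_time, polyPath_reverse, map_polyPath (f := flipMap) fun p q r t => ?affine]
  case affine =>
    ext m
    fin_cases m <;> simp [flipMap] <;> ring
  exact polyPath_congr (fun k hk => by rw [flipMap_gridPoint, hw k hk]) _

theorem flipMap_standardArc (i : Fin 4) (s : ℝ) :
    flipMap (standardArc (2 - i) (5 - s)) = standardArc i s := by
  fin_cases i
  · change flipMap (flipMap (twistedArc (5 - (5 - s)))) = twistedArc s
    rw [flipMap_flipMap, sub_sub_cancel]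
  · exact flipMap_polygonArc_reverse (by decide) s
  · rfl
  · exact flipMap_polygonArc_reverse (by decide) s

theorem untwist_standardArc (i : Fin 4) {s : ℝ} (hs : s ∈ Set.Icc (0 : ℝ) 5) :
    untwist 1 (standardArc i s) = mirrorMap (standardArc i s) := by
  fin_cases i
  · exact untwist_twistedArc hs
  · exact (untwist_middleArc hs).trans
      (mirrorMap_of_apply_two (polygonArc_vertices_apply_two (by decide) s)).symm
  · exact untwist_flipMap_twistedArc ⟨by linarith [hs.2], by linarith [hs.1]⟩
  · exact (untwist_lowerArc hs).trans
      (mirrorMap_of_apply_two (polygonArc_vertices_apply_two (by decide) s)).symm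

theorem flipMap_mirrorMap_comm (p : R3) : flipMap (mirrorMap p) = mirrorMap (flipMap p) := by
  ext m
  fin_cases m <;> simp [flipMap, mirrorMap]

theorem flipMap_mirrorMap_linkPiece (J : StringLink) (i : Fin 4) (τ : ℝ) :
    flipMap (mirrorMap (linkPiece J 0 i.rev (1 - τ))) = linkPiece J 0 i τ := by
  ext m
  fin_cases i <;> fin_cases m <;>
    simp [Fin.rev, linkPiece, passageSide, passageStrand, passageTime, cylinderBase, cylinderSymm,
      flipMap, mirrorMap, add_comm]

theorem blockTime_rev (n : ℤ) (i : Fin 4) (s : ℝ) :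
    blockTime (-n) i.rev (19 / 24 - s) = 1 - blockTime n i s := by
  fin_cases i <;> simp [blockTime, Fin.rev] <;> ring

theorem exists_blockTime_two_sub (n : ℤ) (i : Fin 4) (s : ℝ) :
    ∃ m : ℤ, blockTime m (2 - i) (19 / 24 - s) = 1 + (5 - (blockTime n i s - 1)) := by
  refine ⟨if i = 3 then -n - 1 else -n, ?_⟩
  fin_cases i <;> simp [blockTime] <;> ring

theorem untwist_standardKnot (J : StringLink) (s : ℝ) :
    untwist 1 (standardKnot J s) = flipMap (mirrorMap (standardKnot J (19 / 24 - s))) := by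
  have hd := decomposes_standardKnot J
  rw [Int.cast_zero] at hd
  obtain ⟨n, i, ⟨hτ, he⟩ | ⟨hv, he⟩⟩ := hd.eventuallyEq s <;> rw [he.eq_of_nhds]
  · rw [untwist_linkPiece J i hτ, hd.apply_of_blockTime (-n) i.rev (19 / 24 - s), blockTime_rev,
      hd.on_piece i.rev _ ⟨by linarith [hτ.2], by linarith [hτ.1]⟩, flipMap_mirrorMap_linkPiece]
  · obtain ⟨m, hm⟩ := exists_blockTime_two_sub n i s
    rw [untwist_standardArc i (Set.Ioo_subset_Icc_self hv),
      hd.apply_of_blockTime m (2 - i) (19 / 24 - s), hm, ← add_assoc,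
      hd.on_arc (2 - i) _ ⟨by linarith [hv.2], by linarith [hv.1]⟩, flipMap_mirrorMap_comm,
      flipMap_standardArc]

/-- The rotation by the angle `π t` about the `y`-axis. -/
def verticalRotate (t : ℝ) (p : R3) : R3 :=
  !₂[p 0 * Real.cos (Real.pi * t) + p 2 * Real.sin (Real.pi * t), p 1,
    p 2 * Real.cos (Real.pi * t) - p 0 * Real.sin (Real.pi * t)]

theorem verticalRotate_zero : verticalRotate 0 = id := by
  funext p
  ext m
  fin_cases m <;> simp [verticalRotate]

theorem verticalRotate_one : verticalRotate 1 = flipMap := by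
  funext p
  ext m
  fin_cases m <;> simp [verticalRotate, flipMap]

theorem verticalRotate_neg (t : ℝ) (p : R3) : verticalRotate (-t) (verticalRotate t p) = p := by
  have h := Real.sin_sq_add_cos_sq (Real.pi * t)
  ext m
  fin_cases m <;> simp [verticalRotate]
  · linear_combination (p 0) * h
  · linear_combination (p 2) * h

theorem contDiff_verticalRotate : ContDiff ℝ ∞ fun q : ℝ × R3 => verticalRotate q.1 q.2 := by
  have h_coord : ∀ i, ContDiff ℝ ∞ fun q : ℝ × R3 => q.2 i :=
    fun i => (contDiff_coord i).comp contDiff_snd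
  have h_angle : ContDiff ℝ ∞ fun q : ℝ × R3 => Real.pi * q.1 := contDiff_const.mul contDiff_fst
  have hc := Real.contDiff_cos.comp h_angle
  have hs := Real.contDiff_sin.comp h_angle
  exact contDiff_vec3 (((h_coord 0).mul hc).add ((h_coord 2).mul hs)) (h_coord 1)
    (((h_coord 2).mul hc).sub ((h_coord 0).mul hs))

theorem IsKnot.isotopic_flip {γ : ℝ → R3} (h : IsKnot γ) : Isotopic γ fun s => flipMap (γ s) :=
  verticalRotate_one ▸
    h.isotopic_ambient contDiff_verticalRotate verticalRotate_zero verticalRotate_neg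

theorem isotopic_reverse_mirror_standardKnot (J : StringLink) :
    Isotopic (standardKnot J) (reverseKnot (mirrorImage (standardKnot J))) := by
  have h_knot := isKnot_standardKnot J
  have h_rev := h_knot.mirror.reverse
  have h_untwist := h_knot.isotopic_ambient contDiff_untwist untwist_zero untwist_neg
  have h_flip := (h_rev.isotopic_shift (-(19 / 24))).trans
    (h_rev.shift (-(19 / 24))).isotopic_flip
  have h_eq : (fun s => untwist 1 (standardKnot J s)) = fun s =>
      flipMap (reverseKnot (mirrorImage (standardKnot J)) (s + -(19 / 24))) := by
    funext s
    rw [untwist_standardKnot, reverseKnot, mirrorImage]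
    congr 3
    ring
  rw [h_eq] at h_untwist
  exact h_untwist.trans h_flip.symm

end

theorem mainTheorem7 (J : StringLink) : NegativeAmphichiral (figureKnot J) :=
  ⟨isKnot_figureKnot J, ((isotopic_standardKnot J).trans
    (isotopic_reverse_mirror_standardKnot J)).trans (isotopic_standardKnot J).symm.reverse_mirror⟩
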